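/- **Activated random walks on $\mathbb Z$, site-wise representation.** A configuration is a map $c:\mathbb Z\to\mathbb N\cup\{\mathfrak s\}$: $c(x)=k\in\mathbb N$ means $k$ active particles at $x$, and $c(x)=\mathfrak s$ one sleeping particle. An array of instructions is a family $\tau=(\tau_{x,i})_{x\in\mathbb Z,\,i\ge 1}$, where each $\tau_{x,i}$ is either a sleep instruction or a jump instruction to some site $y\in\mathbb Z$. Toppling $x$ for the $i$-th time means applying $\tau_{x,i}$: a sleep instruction puts the particle at $x$ to sleep if it is alone and does nothing otherwise; a jump instruction to $y$ moves one particle from $x$ to $y$, waking up the sleeping particle at $y$ if there is one. A finite sequence of sites is $\tau$-legal for $c$ if, starting from $c$ with no instruction used and toppling these sites one after another, each site contains at least one active particle when it is toppled. For $V\subset\mathbb Z$, let $m^\tau_{V,c}(x)\in\mathbb N\cup\{\infty\}$ be the supremum, over the $\tau$-legal sequences for $c$ of sites of $V$, of the number of occurrences of $x$, and let $m^\tau_c=m^\tau_{\mathbb Z,c}$. A jump distribution is a map $P:\mathbb Z\times\mathbb Z\to[0,1]$ with $\sum_yP(x,y)=1$ for every $x$; it is nearest-neighbour if $P(x,y)=0$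 unless $|x-y|=1$, and translation-invariant if $P(x,y)$ depends only on $y-x$. For $\lambda\ge 0$, let $\mathcal P_{\lambda,P}$ be the law of an array of independent instructions such that $\tau_{x,i}$ is a sleep instruction with probability $\lambda/(1+\lambda)$ and a jump instruction to $y$ with probability $P(x,y)/(1+\lambda)$. For $n\ge 1$ let $V_n=(-n/2,n/2]\cap\mathbb Z$ and $B_k=V_n+kn$ for $k\in\mathbb Z$. For $\eta:V_n\to\mathbb N$, let $M_n$ be the number of particles that jump out of $V_n$ when the configuration equal to $\eta$ on $V_n$ (all particles active) and to $0$ elsewhere is stabilized in $V_n$ (only sites of $V_n$ are toppled), that is to say, the number of jump instructions to sites outside $V_n$ among the instructions $\tau_{x,i}$ with $x\in V_n$ and $1\le i\le m^\tau_{V_n,\eta}(x)$. Let $\mathbb P_\eta(M_n=0)$ be the probability that $M_n=0$ when $\tau$ has law $\mathcal P_{\lambda,P}$. For $\xi\in\mathbb N^{\mathbb Z}$ define $\varphi_\eta(\xi)\in\mathbb N^{\mathbb Z}$ by $\varphi_\eta(\xi)(x)=\xi(k)\,\eta(x-kn)$ for $x\in B_k$, and for a probability distribution $\nu$ on $\mathbb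 N^{\mathbb Z}$ let $\nu_\eta=(\varphi_\eta)_\star\nu$. **Proposition.** Let $\lambda>0$, let $P$ be a translation-invariant nearest-neighbour jump distribution on $\mathbb Z$, let $n\ge1$, let $\eta:V_n\to\mathbb N$ with $\eta\ne0$, and let $p=\mathbb P_\eta(M_n=0)$. Then $p<1$. Let $\lambda'=p/(1-p)$ and let $D$ be a nearest-neighbour jump distribution directed towards the origin, i.e. $D(x,x-1)=D(-x,-x+1)=1$ for every $x\ge1$. Then for every probability distribution $\nu$ on $\mathbb N^{\mathbb Z}$ there exist, on a common probability space, random pairs $(\xi,\tau)$ with law $\nu_\eta\otimes\mathcal P_{\lambda,P}$ (the block model) and $(\xi',\tau')$ with law $\nu\otimes\mathcal P_{\lambda',D}$ (the coarse-grained model) such that $$\big\{m^{\tau'}_{\xi'}(0)=0\big\}\subset\big\{\forall x\in B_0,\ m^{\tau}_{\xi}(x)=0\big\},$$ that is, if the origin is never visited in the coarse-grained model, then no site of $B_0$ is ever toppled in the block model. -/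

import Mathlib

open MeasureTheory
open scoped ENNReal NNReal

namespace ARW

/-- State of a site: `active k` means `k` active particles (`active 0` is an empty site),
`sleeping` means exactly one particle, which is asleep. -/
inductive SiteState
  | active (k : ℕ)
  | sleeping

/-- At least one active particle is present. -/
def SiteState.IsActive : SiteState → Prop
  | .active k => 1 ≤ k
  | .sleeping => False

/-- A particle arrives and wakes up the sleeping particle if there is one. -/
def SiteState.arrive : SiteState → SiteState
  | .active k => .active (k + 1)
  | .sleeping => .active 2

/-- One particle leaves (a sleeping particle is first woken up). -/
def SiteState.leave : SiteState → SiteState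
  | .active k => .active (k - 1)
  | .sleeping => .active 0

/-- A particle tries to fall asleep: this succeeds if it is alone, and changes nothing
otherwise. -/
def SiteState.trySleep : SiteState → SiteState
  | .active 1 => .sleeping
  | s => s

/-- Configurations on `ℤ`. -/
abbrev Config := ℤ → SiteState

/-- The configuration with `ξ x` active particles at each site `x` and no sleeping particle. -/
def allActive (ξ : ℤ → ℕ) : Config := fun x => .active (ξ x)

/-- Instructions: fall asleep, or jump to the site `y`. -/
inductive Instr
  | sleep
  | jump (y : ℤ)

instance : MeasurableSpace Instr := ⊤

/-- Arrays of instructions: `τ (x, i)` is the `(i+1)`-st instruction at the site `x`. -/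
abbrev InstrArray := ℤ × ℕ → Instr

/-- Effect on a configuration of using an instruction at the site `x`. -/
def applyInstr (x : ℤ) : Instr → Config → Config
  | .sleep, c => Function.update c x (c x).trySleep
  | .jump y, c =>
      let c' := Function.update c x (c x).leave
      Function.update c' y (c' y).arrive

/-- Toppling of the site `x`: the next unused instruction at `x` is applied to the configuration
and the odometer at `x` increases by one. -/
def topple (τ : InstrArray) (x : ℤ) (σ : Config × (ℤ → ℕ)) : Config × (ℤ → ℕ) :=
  (applyInstr x (τ (x, σ.2 x)) σ.1, Function.update σ.2 x (σ.2 x + 1))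

/-- The toppling sequence is `τ`-legal from `σ`: every toppled site contains an active particle
at the time when it is toppled. -/
def IsLegal (τ : InstrArray) : List ℤ → Config × (ℤ → ℕ) → Prop
  | [], _ => True
  | x :: α, σ => (σ.1 x).IsActive ∧ IsLegal τ α (topple τ x σ)

/-- Odometer of the stabilization of `c` in `V`: the supremum of the odometers of the legal toppling
sequences contained in `V`. -/
noncomputable def odometerIn (V : Set ℤ) (τ : InstrArray) (c : Config) (x : ℤ) : ℕ∞ :=
  ⨆ (α : List ℤ) (_ : IsLegal τ α (c, fun _ => 0) ∧ ∀ y ∈ α, y ∈ V), (α.count x : ℕ∞)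

/-- Total stabilization odometer of `c`. -/
noncomputable def odometer (τ : InstrArray) (c : Config) (x : ℤ) : ℕ∞ :=
  ⨆ (α : List ℤ) (_ : IsLegal τ α (c, fun _ => 0)), (α.count x : ℕ∞)

/-- Number of particles that jump out of `V` during the stabilization of `c` in `V` (particles
outside `V` do not move): the number of instructions used at sites of `V` which are
jumps to a site outside `V`. -/
noncomputable def exitCount (V : Set ℤ) (τ : InstrArray) (c : Config) : ℕ∞ :=
  Set.encard {a : ℤ × ℕ | a.1 ∈ V ∧ (a.2 : ℕ∞) < odometerIn V τ c a.1 ∧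
    ∃ y, y ∉ V ∧ τ a = .jump y}

/-- A jump distribution `P` is encoded as `P : ℤ → PMF ℤ`, where `P x y` is the probability to jump
from `x` to `y`. -/
def IsTranslationInvariant (P : ℤ → PMF ℤ) : Prop :=
  ∀ x y z, P (x + z) (y + z) = P x y

/-- Jumps are only to the two neighbours `x - 1` and `x + 1`. -/
def IsNearestNeighbour (P : ℤ → PMF ℤ) : Prop :=
  ∀ x y, |y - x| ≠ 1 → P x y = 0

/-- From every site but the origin the jumps are directed towards the origin. -/
def IsDirectedToOrigin (D : ℤ → PMF ℤ) : Prop :=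
  ∀ x : ℤ, 1 ≤ x → D x (x - 1) = 1 ∧ D (-x) (-x + 1) = 1

/-- Probability of each instruction at the site `x`, with sleep rate `lam` and jump
distribution `P`. -/
noncomputable def instrWeight (lam : ℝ≥0) (P : ℤ → PMF ℤ) (x : ℤ) : Instr → ℝ≥0∞
  | .sleep => (lam : ℝ≥0∞) / (1 + lam)
  | .jump y => P x y / (1 + lam)

theorem hasSum_instrWeight (lam : ℝ≥0) (P : ℤ → PMF ℤ) (x : ℤ) :
    HasSum (instrWeight lam P x) 1 := by
  let e : Option ℤ ≃ Instr :=
    { toFun := fun o => o.elim .sleep .jump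
      invFun := fun i => match i with
        | .sleep => none
        | .jump y => some y
      left_inv := by intro o; cases o <;> rfl
      right_inv := by intro i; cases i <;> rfl }
  have h0 : (1 + lam : ℝ≥0∞) ≠ 0 := by simp
  have h1 : (1 + lam : ℝ≥0∞) ≠ ⊤ := by simp
  have key : ∑' o, instrWeight lam P x (e o) = 1 := by
    rw [ENNReal.tsum_eq_add_tsum_ite none]
    have hs : ∑' o : Option ℤ, (if o = none then 0 else instrWeight lam P x (e o)) =
        ∑' y : ℤ, P x y / (1 + lam) := by
      refine ((Option.some_injective ℤ).tsum_eq ?_).symm.trans ?_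
      · intro o ho
        cases o with
        | none => simp at ho
        | some y => exact ⟨y, rfl⟩
      · rfl
    trans instrWeight lam P x (e none) + ∑' y : ℤ, P x y / (1 + lam)
    · congr 1
      convert hs
    simp only [div_eq_mul_inv]
    rw [ENNReal.tsum_mul_right, PMF.tsum_coe]
    change (lam : ℝ≥0∞) / (1 + lam) + _ = 1
    rw [div_eq_mul_inv, ← add_mul, add_comm (lam : ℝ≥0∞)]
    exact ENNReal.mul_inv_cancel h0 h1
  rw [e.tsum_eq (instrWeight lam P x)] at key
  exact key ▸ ENNReal.summable.hasSum

/-- Law of a single instruction at the site `x`. -/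
noncomputable def instrPMF (lam : ℝ≥0) (P : ℤ → PMF ℤ) (x : ℤ) : PMF Instr :=
  ⟨instrWeight lam P x, hasSum_instrWeight lam P x⟩

/-- Law of the array of independent instructions. -/
noncomputable def instrLaw (lam : ℝ≥0) (P : ℤ → PMF ℤ) : Measure InstrArray :=
  Measure.infinitePi fun a : ℤ × ℕ => (instrPMF lam P a.1).toMeasure

/-- The segment `(-n/2, n/2] ∩ ℤ`. -/
def box (n : ℕ) : Set ℤ := {x | -(n : ℤ) < 2 * x ∧ 2 * x ≤ n}

/-- The block number `k`, namely `box n + k n`. -/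
def block (n : ℕ) (k : ℤ) : Set ℤ := {x | x - k * n ∈ box n}

open Classical in
/-- Extension by zero of a configuration on `box n`. -/
noncomputable def extendZero {n : ℕ} (η : box n → ℕ) (x : ℤ) : ℕ :=
  if h : x ∈ box n then η ⟨x, h⟩ else 0

/-- The probability that no particle jumps out of `box n` when the configuration `η` (with all
particles active) is stabilized in `box n`. -/
noncomputable def probNoExit (lam : ℝ≥0) (P : ℤ → PMF ℤ) (n : ℕ) (η : box n → ℕ) : ℝ≥0 :=
  (instrLaw lam P {τ | exitCount (box n) τ (allActive (extendZero η)) = 0}).toNNReal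

/-- The number of the block that contains `x`, see `mem_block_iff`. -/
def blockIndex (n : ℕ) (x : ℤ) : ℤ := -(((n : ℤ) - 2 * x) / (2 * n))

theorem mem_block_iff {n : ℕ} (hn : 1 ≤ n) (k x : ℤ) : x ∈ block n k ↔ blockIndex n x = k := by
  have h2 : (0 : ℤ) < 2 * n := by omega
  have hd : blockIndex n x = k ↔ ((n : ℤ) - 2 * x) / (2 * n) = -k := by
    unfold blockIndex
    omega
  rw [hd, Int.ediv_eq_iff_of_pos h2]
  simp only [block, box, Set.mem_ofPred_eq]
  constructor
  · rintro ⟨h3, h4⟩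
    constructor <;> nlinarith
  · rintro ⟨h3, h4⟩
    constructor <;> nlinarith

/-- The block configuration obtained from `ξ`: the block number `k` contains `ξ k` copies of `η`,
see `blockConfig_apply`. -/
noncomputable def blockConfig {n : ℕ} (η : box n → ℕ) (ξ : ℤ → ℕ) (x : ℤ) : ℕ :=
  ξ (blockIndex n x) * extendZero η (x - blockIndex n x * n)

theorem blockConfig_apply {n : ℕ} (hn : 1 ≤ n) (η : box n → ℕ) (ξ : ℤ → ℕ) (k x : ℤ)
    (hx : x ∈ block n k) : blockConfig η ξ x = ξ k * η ⟨x - k * n, hx⟩ := by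
  have h := (mem_block_iff hn k x).1 hx
  have hx' : x - k * n ∈ box n := hx
  simp [blockConfig, h, extendZero, hx']

theorem measurable_blockConfig {n : ℕ} (η : box n → ℕ) : Measurable (blockConfig η) :=
  measurable_pi_lambda _ fun _ => (measurable_pi_apply _).mul_const _

/-- Joint law of the initial configuration and of the array of instructions in the block model,
whose initial law is the image of `ν` under `blockConfig η`. -/
noncomputable def blockModel (lam : ℝ≥0) (P : ℤ → PMF ℤ) {n : ℕ} (η : box n → ℕ)
    (ν : Measure (ℤ → ℕ)) : Measure ((ℤ → ℕ) × InstrArray) :=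
  (ν.map (blockConfig η)).prod (instrLaw lam P)

/-- Joint law of the initial configuration and of the array of instructions in the model with
initial law `ν`, sleep rate `lam` and jump distribution `D`. -/
noncomputable def arwModel (lam : ℝ≥0) (D : ℤ → PMF ℤ) (ν : Measure (ℤ → ℕ)) :
    Measure ((ℤ → ℕ) × InstrArray) :=
  ν.prod (instrLaw lam D)

end ARW

/-! An event can be coupled inside another as soon as its probability is not larger
(`exists_coupling`). It therefore suffices to compare, for each fixed `ξ`, the probability that the
origin is avoided in the coarse-grained model with the probability that `block n 0` is avoided in
the block model. Both are values of `avoidProb`. By the abelian property, `avoidProb` is harmonic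
under legal topplings of sites of `V` outside the target (`avoidProb_le_integral`,
`integral_le_avoidProb`); by monotonicity it decreases when particles are added or woken
(`avoidProb_anti`).

The comparison is done in a finite window by induction on a potential (`avoidProb_coarse_le`). A
coarse particle at `k` stands for `|η|` particles in block `k`, and the active coarse site `k`
nearest to the origin is toppled. If it carries at least two particles, a sleep instruction has no
effect there, so only the jump matters. If it carries one, block `k` contains exactly a copy of `η`,
which is stabilized inside the block (`avoidProb_copyAt`). With probability at least `p`, the sleep
probability of the coarse model, nothing exits, and the block is declared asleep; otherwise the
procedure stops at the first exit. To imitate a coarse jump, `|η|` particles are then rearranged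
into a copy of `η` in the next block towards the origin, and that block is woken. This only lowers
the avoidance probability: as a function of the position of one active particle it is superharmonic,
and it is maximal when the particle is outside the window (`avoidProb_move`). Since the nearest
active site is always the one toppled, no block beyond an active one sleeps, so these displacements
stay among awake blocks.

Almost sure stabilization in a box is replaced by a contraction (`escape_bound`): an active particle
has a probability bounded below of leaving the box by jumps in a fixed direction. This gives `p < 1`
and the comparison principle `le_of_superharmonic`. Letting the window grow concludes. -/

namespace ARW

/-! ### Order on the states of a site -/

namespace SiteState

/-- The rank of a state in the total order `0 < 𝔰 < 1 < 2 < ⋯`. -/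
def rank : SiteState → ℕ
  | active 0 => 0
  | sleeping => 1
  | active (k + 1) => k + 2

/-- The number of particles. -/
def total : SiteState → ℕ
  | active k => k
  | sleeping => 1

instance : Preorder SiteState := Preorder.lift rank

theorem le_def (s t : SiteState) : s ≤ t ↔ s.rank ≤ t.rank := Iff.rfl

theorem arrive_mono {s t : SiteState} (h : s ≤ t) : s.arrive ≤ t.arrive := by
  rw [le_def] at *
  rcases s with (_ | _) | _ <;> rcases t with (_ | _) | _ <;> simp_all [rank, arrive]

theorem leave_mono {s t : SiteState} (h : s ≤ t) : s.leave ≤ t.leave := by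
  rw [le_def] at *
  rcases s with (_ | _ | _) | _ <;> rcases t with (_ | _ | _) | _ <;>
    simp_all [rank, leave]

theorem trySleep_mono {s t : SiteState} (h : s ≤ t) : s.trySleep ≤ t.trySleep := by
  rw [le_def] at *
  rcases s with (_ | _ | _) | _ <;> rcases t with (_ | _ | _) | _ <;>
    simp_all [rank, trySleep]

theorem le_arrive (s : SiteState) : s ≤ s.arrive := by
  rw [le_def]
  rcases s with (_ | _) | _ <;> simp [rank, arrive]

theorem trySleep_le (s : SiteState) : s.trySleep ≤ s := by
  rw [le_def]
  rcases s with (_ | _ | _) | _ <;> simp [rank, trySleep]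

theorem IsActive.mono {s t : SiteState} (h : s ≤ t) (hs : s.IsActive) : t.IsActive := by
  rw [le_def] at *
  rcases s with (_ | _) | _ <;> rcases t with (_ | _) | _ <;> simp_all [rank, IsActive]

theorem IsActive.ne_empty {s : SiteState} (hs : s.IsActive) : s ≠ active 0 := by
  rintro rfl
  simp [IsActive] at hs

theorem arrive_isActive (s : SiteState) : s.arrive.IsActive := by
  rcases s with (_ | _) | _ <;> simp [arrive, IsActive]

theorem arrive_ne_empty (s : SiteState) : s.arrive ≠ active 0 :=
  (arrive_isActive s).ne_empty

/-- Nonemptiness matters: on an empty site the truncated `leave` does nothing, so the two orders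
differ by one particle. In `arrive_trySleep`, a newcomer on an empty site could fall asleep. -/
theorem arrive_leave {s : SiteState} (hs : s ≠ active 0) : s.arrive.leave = s.leave.arrive := by
  rcases s with (_ | _) | _ <;> simp_all [arrive, leave]

theorem arrive_trySleep {s : SiteState} (hs : s ≠ active 0) :
    s.arrive.trySleep = s.trySleep.arrive := by
  rcases s with (_ | _ | _) | _ <;> simp_all [arrive, trySleep]

theorem total_arrive (s : SiteState) : s.arrive.total = s.total + 1 := by
  rcases s with k | _ <;> simp [arrive, total]

theorem total_leave (s : SiteState) : s.leave.total = s.total - 1 := by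
  rcases s with k | _ <;> simp [leave, total]

theorem total_trySleep (s : SiteState) : s.trySleep.total = s.total := by
  rcases s with (_ | _ | _) | _ <;> simp [trySleep, total]

theorem IsActive.total_pos {s : SiteState} (hs : s.IsActive) : 0 < s.total := by
  rcases s with (_ | _) | _ <;> simp_all [IsActive, total]

theorem eq_of_not_isActive {s : SiteState} (hs : ¬ s.IsActive) :
    s = if s.total = 0 then active 0 else sleeping := by
  rcases s with (_ | _) | _ <;> simp_all [IsActive, total]

theorem eq_empty_of_not_isActive {s : SiteState} (hs : ¬ s.IsActive) (h : s ≠ sleeping) :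
    s = active 0 := by
  rcases s with (_ | _) | _ <;> simp_all [IsActive]

theorem le_active_of_total_le {s : SiteState} {k : ℕ} (h : s.total ≤ k) : s ≤ active k := by
  rw [le_def]
  rcases s with (_ | _) | _ <;> rcases k with _ | k <;> simp_all [total, rank]

end SiteState

/-! ### Monotonicity and abelian property -/

/-- The effect of using an instruction at `x` on the state of the site `z`. -/
noncomputable def siteEffect (x : ℤ) : Instr → ℤ → SiteState → SiteState
  | .sleep, z, s => if z = x then s.trySleep else s
  | .jump y, z, s =>
      if z = y then (if z = x then s.leave else s).arrive else (if z = x then s.leave else s)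

theorem applyInstr_apply (x : ℤ) (ι : Instr) (c : Config) (z : ℤ) :
    applyInstr x ι c z = siteEffect x ι z (c z) := by
  cases ι with
  | sleep =>
    by_cases h : z = x
    · subst h; simp [applyInstr, siteEffect]
    · simp [applyInstr, siteEffect, h]
  | jump y =>
    by_cases h : z = y <;> by_cases h' : z = x <;>
      simp_all [applyInstr, siteEffect, Function.update_apply]

theorem siteEffect_mono (x : ℤ) (ι : Instr) (z : ℤ) {s t : SiteState} (h : s ≤ t) :
    siteEffect x ι z s ≤ siteEffect x ι z t := by
  cases ι with
  | sleep =>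
    simp only [siteEffect]
    split_ifs
    exacts [SiteState.trySleep_mono h, h]
  | jump y =>
    simp only [siteEffect]
    split_ifs
    exacts [SiteState.arrive_mono (SiteState.leave_mono h), SiteState.arrive_mono h,
      SiteState.leave_mono h, h]

/-- Away from the toppled site the only possible change is an arrival, so commutation of topplings
reduces to commutation with arrivals. -/
theorem siteEffect_of_ne {x z : ℤ} (h : z ≠ x) (ι : Instr) :
    (∀ s, siteEffect x ι z s = s) ∨ (∀ s, siteEffect x ι z s = s.arrive) := by
  cases ι with
  | sleep => left; intro s; simp [siteEffect, h]
  | jump y =>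
    by_cases hy : z = y
    · right; intro s
      subst hy
      simp [siteEffect, h]
    · left; intro s; simp [siteEffect, h, hy]

theorem siteEffect_arrive {x : ℤ} (ι : Instr) (z : ℤ) {s : SiteState} (hs : s ≠ .active 0) :
    siteEffect x ι z s.arrive = (siteEffect x ι z s).arrive := by
  cases ι with
  | sleep =>
    simp only [siteEffect]
    split_ifs
    exacts [SiteState.arrive_trySleep hs, rfl]
  | jump y =>
    simp only [siteEffect]
    split_ifs
    exacts [by rw [SiteState.arrive_leave hs], rfl, SiteState.arrive_leave hs, rfl]

theorem applyInstr_comm {x y : ℤ} (hxy : x ≠ y) (ι κ : Instr) {c : Config}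
    (hx : c x ≠ .active 0) (hy : c y ≠ .active 0) :
    applyInstr y κ (applyInstr x ι c) = applyInstr x ι (applyInstr y κ c) := by
  funext z
  simp only [applyInstr_apply]
  by_cases hzx : z = x
  · subst hzx
    rcases siteEffect_of_ne hxy κ with h | h
    · simp only [h]
    · simp only [h, siteEffect_arrive ι z hx]
  · rcases siteEffect_of_ne hzx ι with h | h
    · simp only [h]
    · by_cases hzy : z = y
      · subst hzy
        simp only [h, siteEffect_arrive κ z hy]
      · rcases siteEffect_of_ne hzy κ with h' | h' <;> simp only [h, h']

theorem applyInstr_ne_empty {x z : ℤ} (h : z ≠ x) (ι : Instr) {c : Config}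
    (hz : c z ≠ .active 0) : applyInstr x ι c z ≠ .active 0 := by
  rw [applyInstr_apply]
  rcases siteEffect_of_ne h ι with h' | h' <;> rw [h']
  exacts [hz, SiteState.arrive_ne_empty _]

theorem le_applyInstr_of_ne {x z : ℤ} (h : z ≠ x) (ι : Instr) (c : Config) :
    c z ≤ applyInstr x ι c z := by
  rw [applyInstr_apply]
  rcases siteEffect_of_ne h ι with h' | h' <;> rw [h']
  exact SiteState.le_arrive _

/-- The same instructions are read in both configurations, and each acts on every site separately by
a monotone map. A comparison on `V` is thus enough. -/
theorem IsLegal.mono {τ : InstrArray} {V : Set ℤ} {α : List ℤ} (hα : ∀ y ∈ α, y ∈ V)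
    {c c' : Config} (hc : ∀ z ∈ V, c z ≤ c' z) {h : ℤ → ℕ} (hl : IsLegal τ α (c, h)) :
    IsLegal τ α (c', h) := by
  induction α generalizing c c' h with
  | nil => trivial
  | cons y α ih =>
    refine ⟨hl.1.mono (hc y (hα y (by simp))), ih (fun z hz => hα z (by simp [hz])) ?_ hl.2⟩
    intro z hz
    simp only [applyInstr_apply]
    exact siteEffect_mono _ _ _ (hc z hz)

/-- Whether a legal sequence in `V` may hit `S`. -/
def CanHit (V S : Set ℤ) (τ : InstrArray) (σ : Config × (ℤ → ℕ)) : Prop :=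
  ∃ α : List ℤ, IsLegal τ α σ ∧ (∀ y ∈ α, y ∈ V) ∧ ∃ y ∈ α, y ∈ S

theorem CanHit.mono {V S : Set ℤ} {τ : InstrArray} {c c' : Config} {h : ℤ → ℕ}
    (hc : ∀ z ∈ V, c z ≤ c' z) (H : CanHit V S τ (c, h)) : CanHit V S τ (c', h) := by
  obtain ⟨α, h1, h2, h3⟩ := H
  exact ⟨α, h1.mono h2 hc, h2, h3⟩

theorem CanHit.of_topple {V S : Set ℤ} {τ : InstrArray} {σ : Config × (ℤ → ℕ)} {x : ℤ}
    (hxV : x ∈ V) (hx : (σ.1 x).IsActive) (H : CanHit V S τ (topple τ x σ)) :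
    CanHit V S τ σ := by
  obtain ⟨α, h1, h2, y, h3, h4⟩ := H
  refine ⟨x :: α, ⟨hx, h1⟩, ?_, y, by simp [h3], h4⟩
  simpa [hxV] using h2

theorem topple_comm {τ : InstrArray} {x y : ℤ} (hxy : x ≠ y) {σ : Config × (ℤ → ℕ)}
    (hx : σ.1 x ≠ .active 0) (hy : σ.1 y ≠ .active 0) :
    topple τ y (topple τ x σ) = topple τ x (topple τ y σ) := by
  simp only [topple, Function.update_of_ne hxy, Function.update_of_ne hxy.symm]
  rw [applyInstr_comm hxy _ _ hx hy, Function.update_comm hxy]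

/-- Abelian property: in a sequence that hits `S`, the first occurrence of `x` can be moved to the
front and dropped. The hit survives because `x ∉ S`, and the other topplings stay legal because
their sites have not lost anything. A particle at `x` is needed, awake or not. -/
theorem CanHit.topple {V S : Set ℤ} {τ : InstrArray} {σ : Config × (ℤ → ℕ)} {x : ℤ}
    (hxS : x ∉ S) (hx : σ.1 x ≠ .active 0) (H : CanHit V S τ σ) :
    CanHit V S τ (topple τ x σ) := by
  obtain ⟨α, h1, h2, h3⟩ := H
  induction α generalizing σ with
  | nil => simp at h3
  | cons y α ih =>
    have h2' : ∀ z ∈ α, z ∈ V := fun z hz => h2 z (by simp [hz])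
    by_cases hyx : y = x
    · subst hyx
      obtain ⟨z, hz, hzS⟩ := h3
      rcases List.mem_cons.1 hz with rfl | hz
      · exact absurd hzS hxS
      · exact ⟨α, h1.2, h2', z, hz, hzS⟩
    · have hact : ((ARW.topple τ x σ).1 y).IsActive :=
        h1.1.mono (le_applyInstr_of_ne hyx _ _)
      by_cases hyS : y ∈ S
      · exact ⟨[y], ⟨hact, trivial⟩, by simpa using h2 y (by simp), y, by simp, hyS⟩
      · have h3' : ∃ z ∈ α, z ∈ S := by
          obtain ⟨z, hz, hzS⟩ := h3
          rcases List.mem_cons.1 hz with rfl | hz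
          · exact absurd hzS hyS
          · exact ⟨z, hz, hzS⟩
        obtain ⟨β, b1, b2, b3⟩ := ih (σ := ARW.topple τ y σ)
          (applyInstr_ne_empty (Ne.symm hyx) _ hx) h1.2 h2' h3'
        rw [← topple_comm (Ne.symm hyx) hx h1.1.ne_empty] at b1
        refine ⟨y :: β, ⟨hact, b1⟩, ?_, ?_⟩
        · simpa [h2 y (by simp)] using b2
        · obtain ⟨z, hz, hzS⟩ := b3
          exact ⟨z, by simp [hz], hzS⟩

/-! ### Revealing the instructions one at a time -/

/-- The array obtained from `τ` by putting the instruction `ι` on top of the stack at `x`. -/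
def consInstr (x : ℤ) (ι : Instr) (τ : InstrArray) : InstrArray
  | (z, i) => if z = x then (match i with
      | 0 => ι
      | i + 1 => τ (x, i)) else τ (z, i)

theorem consInstr_update (x : ℤ) (ι : Instr) (τ : InstrArray) (h : ℤ → ℕ) (z : ℤ) :
    consInstr x ι τ (z, Function.update h x (h x + 1) z) = τ (z, h z) := by
  by_cases hz : z = x
  · subst hz; simp [consInstr]
  · simp [consInstr, hz]

/-- Once the top instruction at `x` is consumed, the unused stacks are those of `τ`. -/
theorem isLegal_consInstr (x : ℤ) (ι : Instr) (τ : InstrArray) (α : List ℤ) (c : Config)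
    (h : ℤ → ℕ) :
    IsLegal (consInstr x ι τ) α (c, Function.update h x (h x + 1)) ↔ IsLegal τ α (c, h) := by
  induction α generalizing c h with
  | nil => exact Iff.rfl
  | cons y α ih =>
    simp only [IsLegal, topple, consInstr_update]
    refine and_congr_right fun _ => ?_
    rw [← ih]
    suffices H : Function.update (Function.update h x (h x + 1)) y
        (Function.update h x (h x + 1) y + 1) =
        Function.update (Function.update h y (h y + 1)) x (Function.update h y (h y + 1) x + 1) by
      rw [H]
    by_cases hyx : y = x
    · subst hyx; simp
    · simp [Function.update_of_ne hyx, Function.update_of_ne (Ne.symm hyx),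
        Function.update_comm hyx]

theorem canHit_topple_consInstr {V S : Set ℤ} (x : ℤ) (ι : Instr) (τ : InstrArray) (c : Config) :
    CanHit V S (consInstr x ι τ) (topple (consInstr x ι τ) x (c, fun _ => 0)) ↔
      CanHit V S τ (applyInstr x ι c, fun _ => 0) := by
  have h0 : consInstr x ι τ (x, 0) = ι := by simp [consInstr]
  simp only [CanHit, topple, h0]
  refine exists_congr fun α => and_congr_left fun _ => ?_
  exact isLegal_consInstr x ι τ α _ _

instance : Countable Instr := by
  have : Function.Injective (fun i : Instr => match i with
      | .sleep => none
      | .jump y => some y) := by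
    intro a b; cases a <;> cases b <;> simp
  exact this.countable

instance : MeasurableSingletonClass Instr := ⟨fun _ => trivial⟩

instance (lam : ℝ≥0) (P : ℤ → PMF ℤ) : IsProbabilityMeasure (instrLaw lam P) := by
  unfold instrLaw; infer_instance

instance : MeasurableSpace SiteState := ⊤

instance : Countable SiteState := by
  have : Function.Injective (fun s : SiteState => match s with
      | .sleeping => none
      | .active k => some k) := by
    intro a b; cases a <;> cases b <;> simp
  exact this.countable

instance : MeasurableSingletonClass SiteState := ⟨fun _ => trivial⟩

/-- The configuration depends on `ω` because the induction replaces it by the random configuration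
after one toppling. -/
theorem measurableSet_isLegal {Ω : Type*} [MeasurableSpace Ω] {τ : Ω → InstrArray}
    (hτ : Measurable τ) (α : List ℤ) {c : Ω → Config} (hc : ∀ z, Measurable fun ω => c ω z)
    (h : ℤ → ℕ) : MeasurableSet {ω | IsLegal (τ ω) α (c ω, h)} := by
  induction α generalizing c h with
  | nil => simp [IsLegal]
  | cons y α ih =>
    have h1 : MeasurableSet {ω | (c ω y).IsActive} :=
      hc y (show MeasurableSet {s : SiteState | s.IsActive} from trivial)
    refine h1.inter (ih (c := fun ω => applyInstr y (τ ω (y, h y)) (c ω)) (fun z => ?_)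
      (Function.update h y (h y + 1)))
    simp only [applyInstr_apply]
    have h2 : Measurable fun q : Instr × SiteState => siteEffect y q.1 z q.2 :=
      measurable_from_prod_countable_right fun _ => measurable_from_top
    exact h2.comp (((measurable_pi_apply _).comp hτ).prodMk (hc z))

theorem measurableSet_canHit_comp {Ω : Type*} [MeasurableSpace Ω] {τ : Ω → InstrArray}
    (hτ : Measurable τ) {c : Ω → Config} (hc : ∀ z, Measurable fun ω => c ω z) (V S : Set ℤ)
    (h : ℤ → ℕ) : MeasurableSet {ω | CanHit V S (τ ω) (c ω, h)} := by
  have : {ω | CanHit V S (τ ω) (c ω, h)} = ⋃ α : List ℤ, ({ω | IsLegal (τ ω) α (c ω, h)} ∩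
      {_ω : Ω | (∀ y ∈ α, y ∈ V) ∧ ∃ y ∈ α, y ∈ S}) := by
    ext ω; simp [CanHit]
  rw [this]
  exact .iUnion fun α => (measurableSet_isLegal hτ α hc h).inter (.const _)

theorem measurableSet_canHit (V S : Set ℤ) (σ : Config × (ℤ → ℕ)) :
    MeasurableSet {τ : InstrArray | CanHit V S τ σ} :=
  measurableSet_canHit_comp (τ := id) (c := fun _ => σ.1) measurable_id
    (fun _ => measurable_const) V S σ.2

theorem measurable_consInstr (x : ℤ) :
    Measurable fun q : Instr × InstrArray => consInstr x q.1 q.2 := by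
  refine measurable_pi_lambda _ fun a => ?_
  obtain ⟨z, _ | i⟩ := a <;> by_cases hz : z = x <;> simp only [consInstr, hz, if_true, if_false]
  exacts [measurable_fst, (measurable_pi_apply _).comp measurable_snd,
    (measurable_pi_apply _).comp measurable_snd, (measurable_pi_apply _).comp measurable_snd]

/-- The instructions at `x` are identically distributed, so an independent fresh one on top of the
stack leaves the law unchanged. -/
theorem map_consInstr (lam : ℝ≥0) (P : ℤ → PMF ℤ) (x : ℤ) :
    ((instrPMF lam P x).toMeasure.prod (instrLaw lam P)).map
      (fun q : Instr × InstrArray => consInstr x q.1 q.2) = instrLaw lam P := by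
  refine Measure.eq_infinitePi _ fun s t ht => ?_
  -- Old instructions move down by one in the stack at `x`; the only position missed is `(x, 0)`.
  let f : ℤ × ℕ → ℤ × ℕ := fun a => (a.1, if a.1 = x then a.2 + 1 else a.2)
  have hf : Function.Injective f := by
    rintro ⟨z, i⟩ ⟨z', i'⟩ h
    simp only [f, Prod.mk.injEq] at h
    obtain ⟨rfl, h⟩ := h
    by_cases hz : z = x <;> simp_all
  have hcf : ∀ ι τ a, consInstr x ι τ (f a) = τ a := by
    rintro ι τ ⟨z, i⟩
    by_cases hz : z = x <;> simp [f, consInstr, hz]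
  have hr : ∀ a, a ∉ Set.range f → a = (x, 0) := by
    rintro ⟨z, i⟩ h
    by_contra hne
    apply h
    by_cases hz : z = x
    · subst hz
      rcases i with _ | i
      · exact absurd rfl hne
      · exact ⟨(z, i), by simp [f]⟩
    · exact ⟨(z, i), by simp [f, hz]⟩
  have hx0 : ∀ a, f a ≠ (x, 0) := by
    rintro ⟨z, i⟩ h
    simp only [f, Prod.mk.injEq] at h
    obtain ⟨rfl, h⟩ := h
    simp at h
  have hpre : (fun q : Instr × InstrArray => consInstr x q.1 q.2) ⁻¹' (Set.pi s t) =
      (if (x, 0) ∈ s then t (x, 0) else Set.univ) ×ˢ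
        Set.pi ↑(s.preimage f hf.injOn) (fun a => t (f a)) := by
    ext ⟨ι, τ⟩
    simp only [Set.mem_preimage, Set.mem_pi, Finset.mem_coe, Set.mem_prod, Finset.mem_preimage]
    constructor
    · intro h
      refine ⟨?_, fun a ha => hcf ι τ a ▸ h _ ha⟩
      split_ifs with h0
      · simpa [consInstr] using h _ h0
      · trivial
    · rintro ⟨h1, h2⟩ a ha
      by_cases har : a ∈ Set.range f
      · obtain ⟨b, rfl⟩ := har
        rw [hcf]; exact h2 b ha
      · rw [hr a har] at ha ⊢
        simpa [consInstr, ha] using h1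
  let g : ℤ × ℕ → ℝ≥0∞ := fun a => (instrPMF lam P a.1).toMeasure (t a)
  have hmap := Measure.map_apply (μ := (instrPMF lam P x).toMeasure.prod (instrLaw lam P))
    (measurable_consInstr x) (MeasurableSet.pi s.countable_toSet fun a _ => ht a)
  have hpi : instrLaw lam P (Set.pi ↑(s.preimage f hf.injOn) (fun a => t (f a))) =
      ∏ a ∈ s.preimage f hf.injOn, g (f a) :=
    Measure.infinitePi_pi _ fun a _ => ht _
  rw [hmap, hpre, Measure.prod_prod, hpi]
  have hprod : ∏ a ∈ s.preimage f hf.injOn, g (f a) = ∏ a ∈ s.erase (x, 0), g a := by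
    have he : s.preimage f hf.injOn = (s.erase (x, 0)).preimage f hf.injOn := by
      ext a; simp [hx0]
    rw [he]
    refine Finset.prod_preimage f (s.erase (x, 0)) hf.injOn g fun a ha har => ?_
    exact absurd (hr a har) (Finset.ne_of_mem_erase ha)
  rw [hprod]
  change _ = ∏ a ∈ s, g a
  by_cases h0 : (x, 0) ∈ s
  · rw [if_pos h0, ← Finset.mul_prod_erase s g h0]
  · rw [if_neg h0, Finset.erase_eq_of_notMem h0, measure_univ, one_mul]

/-! ### Avoidance probabilities and harmonicity -/

/-- The probability that no legal sequence in `V` hits `S`. -/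
noncomputable def avoidProb (lam : ℝ≥0) (P : ℤ → PMF ℤ) (V S : Set ℤ) (c : Config) : ℝ :=
  (instrLaw lam P).real {τ | ¬ CanHit V S τ (c, fun _ => 0)}

section avoidProb

variable {lam : ℝ≥0} {P : ℤ → PMF ℤ} {V S : Set ℤ}

theorem avoidProb_nonneg (c : Config) : 0 ≤ avoidProb lam P V S c := measureReal_nonneg

theorem avoidProb_le_one (c : Config) : avoidProb lam P V S c ≤ 1 := measureReal_le_one

theorem avoidProb_anti {c c' : Config} (hc : ∀ z ∈ V, c z ≤ c' z) :
    avoidProb lam P V S c' ≤ avoidProb lam P V S c :=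
  measureReal_mono fun _ h h' => h (h'.mono hc)

theorem avoidProb_eq_zero {c : Config} {x : ℤ} (hV : x ∈ V) (hS : x ∈ S) (hx : (c x).IsActive) :
    avoidProb lam P V S c = 0 := by
  have : {τ | ¬ CanHit V S τ (c, fun _ => 0)} = ∅ := by
    ext τ
    simp only [Set.mem_ofPred_eq, Set.mem_empty_iff_false, iff_false, not_not]
    exact ⟨[x], ⟨hx, trivial⟩, by simpa using hV, x, by simp, hS⟩
  simp [avoidProb, this]

theorem avoidProb_eq_one {c : Config} (hc : ∀ z ∈ V, ¬ (c z).IsActive) :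
    avoidProb lam P V S c = 1 := by
  have : {τ | ¬ CanHit V S τ (c, fun _ => 0)} = Set.univ := by
    ext τ
    simp only [Set.mem_ofPred_eq, Set.mem_univ, iff_true]
    rintro ⟨α, h1, h2, y, h3, -⟩
    cases α with
    | nil => simp at h3
    | cons z α => exact hc z (h2 z (by simp)) h1.1
  simp [avoidProb, this]

/-- Conditioning on the first instruction at `x`. -/
theorem avoidProb_eq_integral (c : Config) (x : ℤ) :
    avoidProb lam P V S c = ∫ ι, (instrLaw lam P).real
      {τ | ¬ CanHit V S (consInstr x ι τ) (c, fun _ => 0)} ∂(instrPMF lam P x).toMeasure := by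
  have hm : MeasurableSet {τ | ¬ CanHit V S τ (c, fun _ => 0)} :=
    (measurableSet_canHit V S (c, fun _ => 0)).compl
  have hm' := measurable_consInstr x hm
  rw [avoidProb, measureReal_def]
  conv_lhs => rw [← map_consInstr lam P x]
  rw [Measure.map_apply (measurable_consInstr x) hm, Measure.prod_apply hm',
    integral_eq_lintegral_of_nonneg_ae (.of_forall fun _ => measureReal_nonneg)
      (Measurable.of_discrete).aestronglyMeasurable]
  congr 1
  refine lintegral_congr fun ι => ?_
  rw [ofReal_measureReal]
  rfl

theorem integrable_instr (x : ℤ) {f : Instr → ℝ} (h0 : ∀ ι, 0 ≤ f ι) (h1 : ∀ ι, f ι ≤ 1) :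
    Integrable f (instrPMF lam P x).toMeasure :=
  .of_bound (Measurable.of_discrete).aestronglyMeasurable 1
    (.of_forall fun ι => by rw [Real.norm_of_nonneg (h0 ι)]; exact h1 ι)

/-- The subharmonic half: a hit after a legal toppling is a hit before it. -/
theorem avoidProb_le_integral {c : Config} {x : ℤ} (hxV : x ∈ V) (hx : (c x).IsActive) :
    avoidProb lam P V S c ≤
      ∫ ι, avoidProb lam P V S (applyInstr x ι c) ∂(instrPMF lam P x).toMeasure := by
  rw [avoidProb_eq_integral c x]
  refine integral_mono (integrable_instr x (fun _ => measureReal_nonneg)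
    fun _ => measureReal_le_one) (integrable_instr x (fun _ => measureReal_nonneg)
    fun _ => measureReal_le_one) fun ι => measureReal_mono fun τ h h' => h ?_
  exact CanHit.of_topple hxV hx ((canHit_topple_consInstr x ι τ c).2 h')

/-- The superharmonic half, from `CanHit.topple`; here `x` may lie outside `V`. -/
theorem integral_le_avoidProb {c : Config} {x : ℤ} (hxS : x ∉ S) (hx : c x ≠ .active 0) :
    ∫ ι, avoidProb lam P V S (applyInstr x ι c) ∂(instrPMF lam P x).toMeasure ≤
      avoidProb lam P V S c := by
  rw [avoidProb_eq_integral c x]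
  refine integral_mono (integrable_instr x (fun _ => measureReal_nonneg)
    fun _ => measureReal_le_one) (integrable_instr x (fun _ => measureReal_nonneg)
    fun _ => measureReal_le_one) fun ι => measureReal_mono fun τ h h' => h ?_
  exact (canHit_topple_consInstr x ι τ c).1 (CanHit.topple hxS hx h')

end avoidProb

section weights

variable {lam : ℝ≥0} {P : ℤ → PMF ℤ}

/-- The probability of a sleep instruction. -/
noncomputable def sleepWeight (lam : ℝ≥0) : ℝ := lam / (1 + lam)

/-- The probability of an instruction to jump from `x` to `y`. -/
noncomputable def jumpWeight (lam : ℝ≥0) (P : ℤ → PMF ℤ) (x y : ℤ) : ℝ :=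
  (P x y).toReal / (1 + lam)

theorem sleepWeight_nonneg : 0 ≤ sleepWeight lam := by unfold sleepWeight; positivity

theorem jumpWeight_nonneg (x y : ℤ) : 0 ≤ jumpWeight lam P x y := by
  unfold jumpWeight; positivity

theorem toReal_instrPMF_sleep (x : ℤ) : (instrPMF lam P x .sleep).toReal = sleepWeight lam := by
  change ((lam : ℝ≥0∞) / (1 + lam)).toReal = _
  rw [ENNReal.toReal_div, ENNReal.toReal_add (by simp) (by simp)]
  simp [sleepWeight]

theorem toReal_instrPMF_jump (x y : ℤ) :
    (instrPMF lam P x (.jump y)).toReal = jumpWeight lam P x y := by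
  change (P x y / (1 + lam)).toReal = _
  rw [ENNReal.toReal_div, ENNReal.toReal_add (by simp) (by simp)]
  simp [jumpWeight]

theorem integral_instrPMF (hP : IsNearestNeighbour P) (x : ℤ) {f : Instr → ℝ}
    (h0 : ∀ ι, 0 ≤ f ι) (h1 : ∀ ι, f ι ≤ 1) :
    ∫ ι, f ι ∂(instrPMF lam P x).toMeasure = sleepWeight lam * f .sleep +
      jumpWeight lam P x (x + 1) * f (.jump (x + 1)) +
      jumpWeight lam P x (x + -1) * f (.jump (x + -1)) := by
  classical
  rw [PMF.integral_eq_tsum _ _ (integrable_instr x h0 h1),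
    tsum_eq_sum (s := {Instr.sleep, .jump (x + 1), .jump (x + -1)})]
  · rw [Finset.sum_insert (by simp), Finset.sum_insert (by simp), Finset.sum_singleton,
      toReal_instrPMF_sleep, toReal_instrPMF_jump, toReal_instrPMF_jump]
    simp only [smul_eq_mul]
    ring
  · intro ι hι
    cases ι with
    | sleep => simp at hι
    | jump y =>
      simp only [Finset.mem_insert, Finset.mem_singleton, Instr.jump.injEq, reduceCtorEq,
        false_or, not_or] at hι
      rw [toReal_instrPMF_jump, jumpWeight, hP x y]
      · simp
      · intro h
        rcases abs_eq (zero_le_one' ℤ) |>.1 h with h | h <;> omega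

theorem sum_weights (hP : IsNearestNeighbour P) (x : ℤ) :
    sleepWeight lam + jumpWeight lam P x (x + 1) + jumpWeight lam P x (x + -1) = 1 := by
  have := integral_instrPMF (lam := lam) hP x (f := fun _ => 1) (by simp) (by simp)
  simpa using this.symm

theorem sleepWeight_lt_one : sleepWeight lam < 1 := by
  unfold sleepWeight
  rw [div_lt_one (by positivity)]
  linarith

theorem jumpWeight_translate (hP : IsTranslationInvariant P) (x e : ℤ) :
    jumpWeight lam P x (x + e) = jumpWeight lam P 0 e := by
  have := hP 0 e x
  rw [zero_add, add_comm e] at this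
  rw [jumpWeight, this, jumpWeight]

theorem exists_jumpWeight_pos (hP : IsNearestNeighbour P) :
    ∃ e : ℤ, (e = 1 ∨ e = -1) ∧ 0 < jumpWeight lam P 0 e := by
  by_contra! h
  have h1 := h 1 (by simp)
  have h2 := h (-1) (by simp)
  have h3 := sum_weights (lam := lam) hP 0
  have h4 := sleepWeight_lt_one (lam := lam)
  simp only [zero_add] at h3
  linarith

end weights

/-! ### Escape from a box, and `p < 1` -/

/-- A subharmonic function which is nonpositive at the exit of `box n` is small at configurations
with an active particle. -/
theorem escape_bound {n : ℕ} {s : ℝ} {w : ℤ → ℝ} (hs : 0 ≤ s) (hw : ∀ e, 0 ≤ w e)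
    (hsum : s + w 1 + w (-1) = 1) {𝒰 : Set Config} {h : Config → ℝ} {K : ℝ}
    (hK : 0 ≤ K) (hb : ∀ u ∈ 𝒰, h u ≤ K)
    (hsleep : ∀ u ∈ 𝒰, ∀ x ∈ box n, (u x).IsActive → applyInstr x .sleep u ∈ 𝒰)
    (hjump : ∀ u ∈ 𝒰, ∀ x ∈ box n, (u x).IsActive → ∀ y ∈ box n, applyInstr x (.jump y) u ∈ 𝒰)
    (t : Config → ℤ → ℤ → ℝ)
    (ht : ∀ u x y, y ∈ box n → t u x y = h (applyInstr x (.jump y) u))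
    (ht0 : ∀ u x y, y ∉ box n → t u x y ≤ 0)
    (hstep : ∀ u ∈ 𝒰, ∀ x ∈ box n, (u x).IsActive →
      h u ≤ s * h (applyInstr x .sleep u) + w 1 * t u x (x + 1) + w (-1) * t u x (x + -1))
    {e : ℤ} (he : e = 1 ∨ e = -1) (i : ℕ) {x : ℤ} (hx : x ∈ box n) (hxi : x + i * e ∉ box n)
    {u : Config} (hu : u ∈ 𝒰) (hux : (u x).IsActive) : h u ≤ (1 - w e ^ i) * K := by
  induction i generalizing x u with
  | zero => simp [hx] at hxi
  | succ i ih =>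
    have hw1 : w e ≤ 1 := by
      rcases he with rfl | rfl
      · linarith [hw (-1)]
      · linarith [hw 1]
    have htK : ∀ y, t u x y ≤ K := by
      intro y
      by_cases hy : y ∈ box n
      · rw [ht u x y hy]
        exact hb _ (hjump u hu x hx hux y hy)
      · exact (ht0 u x y hy).trans hK
    have hte : t u x (x + e) ≤ (1 - w e ^ i) * K := by
      by_cases hy : x + e ∈ box n
      · rw [ht u x _ hy]
        refine ih hy ?_ (hjump u hu x hx hux _ hy) ?_
        · push_cast at hxi
          rwa [show x + e + i * e = x + (i + 1) * e by ring]
        · simp only [applyInstr, Function.update_self]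
          exact SiteState.arrive_isActive _
      · refine (ht0 u x _ hy).trans (mul_nonneg ?_ hK)
        exact sub_nonneg.2 (pow_le_one₀ (hw e) hw1)
    have h1 := hstep u hu x hx hux
    have h2 := mul_le_mul_of_nonneg_left (hb _ (hsleep u hu x hx hux)) hs
    have h3 := mul_le_mul_of_nonneg_left hte (hw e)
    -- The outcomes other than the jump in direction `e` are bounded by `K`, that jump by the
    -- induction hypothesis, and the weights sum to 1.
    rw [pow_succ]
    rcases he with rfl | rfl
    · have h4 := mul_le_mul_of_nonneg_left (htK (x + -1)) (hw (-1))
      have : s = 1 - w 1 - w (-1) := by linarith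
      subst this
      linarith
    · have h4 := mul_le_mul_of_nonneg_left (htK (x + 1)) (hw 1)
      have : s = 1 - w 1 - w (-1) := by linarith
      subst this
      linarith

theorem add_mul_notMem_box {n : ℕ} {e x : ℤ} (he : e = 1 ∨ e = -1) (hx : x ∈ box n) :
    x + n * e ∉ box n := by
  simp only [box, Set.mem_ofPred_eq] at *
  rcases he with rfl | rfl <;> omega

section noExit

variable {lam : ℝ≥0} {P : ℤ → PMF ℤ} {n : ℕ}

/-- The probability that no particle ever leaves `box n`. -/
noncomputable def stayProb (lam : ℝ≥0) (P : ℤ → PMF ℤ) (n : ℕ) (u : Config) : ℝ :=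
  avoidProb lam P Set.univ (box n)ᶜ u

theorem stayProb_exit {x y : ℤ} (hy : y ∉ box n) (u : Config) :
    stayProb lam P n (applyInstr x (.jump y) u) = 0 := by
  refine avoidProb_eq_zero (Set.mem_univ y) hy ?_
  simp only [applyInstr, Function.update_self]
  exact SiteState.arrive_isActive _

theorem stayProb_step (hPt : IsTranslationInvariant P) (hPn : IsNearestNeighbour P) {u : Config}
    {x : ℤ} (hux : (u x).IsActive) :
    stayProb lam P n u ≤ sleepWeight lam * stayProb lam P n (applyInstr x .sleep u) +
      jumpWeight lam P 0 1 * stayProb lam P n (applyInstr x (.jump (x + 1)) u) +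
      jumpWeight lam P 0 (-1) * stayProb lam P n (applyInstr x (.jump (x + -1)) u) := by
  rw [← jumpWeight_translate hPt x 1, ← jumpWeight_translate hPt x (-1)]
  refine (avoidProb_le_integral (Set.mem_univ x) hux).trans_eq ?_
  exact integral_instrPMF hPn x (fun _ => avoidProb_nonneg _) fun _ => avoidProb_le_one _

/-- `escape_bound` with `K = 1`: following `n` jumps in a direction of positive weight leads out of
the box. -/
theorem stayProb_lt_one (hPt : IsTranslationInvariant P) (hPn : IsNearestNeighbour P) {u : Config}
    {x : ℤ} (hx : x ∈ box n) (hux : (u x).IsActive) : stayProb lam P n u < 1 := by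
  obtain ⟨e, he, hpos⟩ := exists_jumpWeight_pos (lam := lam) hPn
  have hsum := sum_weights (lam := lam) hPn 0
  simp only [zero_add] at hsum
  have := escape_bound (n := n) (w := jumpWeight lam P 0) sleepWeight_nonneg
    (fun e => jumpWeight_nonneg _ _) hsum
    (𝒰 := Set.univ) (h := stayProb lam P n) zero_le_one (fun u _ => avoidProb_le_one u)
    (by simp) (by simp) (fun u x y => stayProb lam P n (applyInstr x (.jump y) u))
    (fun _ _ _ _ => rfl) (fun u x y hy => (stayProb_exit hy u).le)
    (fun u _ x _ hux => stayProb_step hPt hPn hux) he n hx (add_mul_notMem_box he hx)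
    (Set.mem_univ u) hux
  have := pow_pos hpos n
  linarith

/-- The first instruction of the sequence that jumps out of `V` is reached by toppling sites of `V`
only, since no particle is outside before it. -/
theorem exists_exit {τ : InstrArray} {V : Set ℤ} {α : List ℤ} {c : Config} {h : ℤ → ℕ}
    (hl : IsLegal τ α (c, h)) (hc : ∀ z ∉ V, c z = .active 0) (hα : ∃ y ∈ α, y ∉ V) :
    ∃ (β : List ℤ) (x : ℤ) (i : ℕ), IsLegal τ β (c, h) ∧ (∀ y ∈ β, y ∈ V) ∧ x ∈ V ∧
      i < h x + β.count x ∧ ∃ y ∉ V, τ (x, i) = .jump y := by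
  induction α generalizing c h with
  | nil => simp at hα
  | cons z α ih =>
    have hz : z ∈ V := by
      by_contra hz
      exact hl.1.ne_empty (hc z hz)
    by_cases hex : ∃ y ∉ V, τ (z, h z) = .jump y
    · exact ⟨[z], z, h z, ⟨hl.1, trivial⟩, by simpa using hz, hz, by simp, hex⟩
    · have hα' : ∃ y ∈ α, y ∉ V := by
        obtain ⟨y, hy, hyV⟩ := hα
        rcases List.mem_cons.1 hy with rfl | hy
        · exact absurd hz hyV
        · exact ⟨y, hy, hyV⟩
      obtain ⟨β, x, i, b1, b2, b3, b4, b5⟩ := ih hl.2 (fun w hw => by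
        have hwz : w ≠ z := by rintro rfl; exact hw hz
        have hwc := hc w hw
        simp only [applyInstr_apply]
        cases hι : τ (z, h z) with
        | sleep => simp [siteEffect, hwz, hwc]
        | jump y =>
          have hwy : w ≠ y := by
            rintro rfl; exact hex ⟨w, hw, hι⟩
          simp [siteEffect, hwz, hwy, hwc]) hα'
      refine ⟨z :: β, x, i, ⟨hl.1, b1⟩, by simpa [hz] using b2, b3, ?_, b5⟩
      by_cases hxz : x = z
      · subst hxz
        simp only [Function.update_self] at b4
        rw [List.count_cons_self]
        omega
      · rw [Function.update_of_ne hxz] at b4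
        rw [List.count_cons_of_ne (Ne.symm hxz)]
        omega

theorem probNoExit_le_stayProb (η : box n → ℕ) :
    (probNoExit lam P n η : ℝ) ≤ stayProb lam P n (allActive (extendZero η)) := by
  refine measureReal_mono fun τ h hhit => ?_
  obtain ⟨α, h1, -, h3⟩ := hhit
  obtain ⟨β, x, i, b1, b2, b3, b4, b5⟩ := exists_exit h1 (V := box n)
    (fun z hz => by simp [allActive, extendZero, hz]) h3
  have : (x, i) ∈ (∅ : Set (ℤ × ℕ)) := by
    rw [← Set.encard_eq_zero.1 h]
    refine ⟨b3, ?_, b5⟩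
    simp only [zero_add] at b4
    refine lt_of_lt_of_le (Nat.cast_lt.2 b4) ?_
    exact le_iSup₂_of_le β ⟨b1, b2⟩ le_rfl
  exact this

theorem probNoExit_lt_one (hPt : IsTranslationInvariant P) (hPn : IsNearestNeighbour P)
    {η : box n → ℕ} (hη : η ≠ 0) : probNoExit lam P n η < 1 := by
  obtain ⟨x, hx⟩ := Function.ne_iff.1 hη
  have := stayProb_lt_one (lam := lam) hPt hPn (u := allActive (extendZero η)) x.2
    (by simpa [allActive, extendZero, SiteState.IsActive, Nat.one_le_iff_ne_zero] using hx)
  exact_mod_cast (probNoExit_le_stayProb η).trans_lt this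

end noExit

/-! ### Comparison principle in a box -/

/-- `u` has the same numbers of particles as `M`, whatever their states. -/
def Carries (u : Config) (M : Multiset ℤ) : Prop := ∀ x, (u x).total = M.count x

theorem Carries.sleep {u : Config} {M : Multiset ℤ} (h : Carries u M) (x : ℤ) :
    Carries (applyInstr x .sleep u) M := by
  intro z
  rw [applyInstr_apply, siteEffect, ← h z]
  split_ifs
  exacts [SiteState.total_trySleep _, rfl]

theorem Carries.mem {u : Config} {M : Multiset ℤ} (h : Carries u M) {x : ℤ}
    (hx : (u x).IsActive) : x ∈ M := by
  rw [← Multiset.count_pos, ← h x]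
  exact hx.total_pos

theorem Carries.jump {u : Config} {M : Multiset ℤ} (h : Carries u M) (x y : ℤ) :
    Carries (applyInstr x (.jump y) u) (y ::ₘ M.erase x) := by
  intro z
  have := h z
  rw [applyInstr_apply, siteEffect]
  by_cases hzx : z = x <;> by_cases hzy : z = y
  · subst hzx; subst hzy
    simp [SiteState.total_arrive, SiteState.total_leave, this]
  · subst hzx
    simp [SiteState.total_leave, this, hzy]
  · subst hzy
    simp [SiteState.total_arrive, this, hzx]
  · simp [this, hzx, hzy]

/-- Configurations of `N` particles in `box n`. -/
def BoxConfigs (n N : ℕ) : Set Config :=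
  {u | ∃ M : Multiset ℤ, M.card = N ∧ (∀ x ∈ M, x ∈ box n) ∧ Carries u M}

theorem BoxConfigs.sleep {n N : ℕ} {u : Config} (hu : u ∈ BoxConfigs n N) (x : ℤ) :
    applyInstr x .sleep u ∈ BoxConfigs n N := by
  obtain ⟨M, h1, h2, h3⟩ := hu
  exact ⟨M, h1, h2, h3.sleep x⟩

theorem BoxConfigs.jump {n N : ℕ} {u : Config} (hu : u ∈ BoxConfigs n N) {x y : ℤ}
    (hx : (u x).IsActive) (hy : y ∈ box n) : applyInstr x (.jump y) u ∈ BoxConfigs n N := by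
  obtain ⟨M, h1, h2, h3⟩ := hu
  refine ⟨_, ?_, ?_, h3.jump x y⟩
  · rw [Multiset.card_cons, Multiset.card_erase_add_one (h3.mem hx), h1]
  · intro z hz
    rcases Multiset.mem_cons.1 hz with rfl | hz
    exacts [hy, h2 z (Multiset.mem_of_mem_erase hz)]

theorem mem_box_of_isActive {n N : ℕ} {u : Config} (hu : u ∈ BoxConfigs n N) {x : ℤ}
    (hx : (u x).IsActive) : x ∈ box n := by
  obtain ⟨M, -, h2, h3⟩ := hu
  exact h2 x (h3.mem hx)

open Classical in
/-- A superharmonic function on the configurations of `box n` which is at least `A` at stable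
configurations and at least `B` when a particle exits is at least the corresponding mean. -/
theorem le_of_superharmonic {lam : ℝ≥0} {P : ℤ → PMF ℤ} (hPt : IsTranslationInvariant P)
    (hPn : IsNearestNeighbour P) {n N : ℕ} {G : Config → ℝ} {A B : ℝ}
    (hAB : B ≤ A) (hA : A - B ≤ 1) (hB : ∀ u ∈ BoxConfigs n N, B ≤ G u)
    (hstable : ∀ u ∈ BoxConfigs n N, (∀ x, ¬ (u x).IsActive) → A ≤ G u)
    (hstep : ∀ u ∈ BoxConfigs n N, ∀ x ∈ box n, (u x).IsActive →
      sleepWeight lam * G (applyInstr x .sleep u) +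
      jumpWeight lam P 0 1 *
        (if x + 1 ∈ box n then G (applyInstr x (.jump (x + 1)) u) else B) +
      jumpWeight lam P 0 (-1) *
        (if x + -1 ∈ box n then G (applyInstr x (.jump (x + -1)) u) else B) ≤ G u)
    {u : Config} (hu : u ∈ BoxConfigs n N) :
    B + stayProb lam P n u * (A - B) ≤ G u := by
  -- `h` is subharmonic, nonpositive at stable configurations and at exits, and at most 1 because `A
  -- - B ≤ 1`.
  set h : Config → ℝ := fun u => B + stayProb lam P n u * (A - B) - G u with hh
  suffices H : ∀ u ∈ BoxConfigs n N, h u ≤ 0 by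
    have := H u hu
    simp only [hh] at this
    linarith
  have hsub : 0 ≤ A - B := sub_nonneg.2 hAB
  have hsum := sum_weights (lam := lam) hPn 0
  simp only [zero_add] at hsum
  obtain ⟨e, he, hpos⟩ := exists_jumpWeight_pos (lam := lam) hPn
  have hle : jumpWeight lam P 0 e ≤ 1 := by
    have h1 := sleepWeight_nonneg (lam := lam)
    have h2 := jumpWeight_nonneg (lam := lam) (P := P) 0 1
    have h3 := jumpWeight_nonneg (lam := lam) (P := P) 0 (-1)
    rcases he with rfl | rfl <;> linarith
  have key : ∀ K : ℝ, 0 ≤ K → (∀ u ∈ BoxConfigs n N, h u ≤ K) →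
      ∀ u ∈ BoxConfigs n N, h u ≤ (1 - jumpWeight lam P 0 e ^ n) * K := by
    intro K hK hbd u hu
    by_cases hact : ∃ x, (u x).IsActive
    · obtain ⟨x, hux⟩ := hact
      have hx := mem_box_of_isActive hu hux
      refine escape_bound (n := n) (w := jumpWeight lam P 0) sleepWeight_nonneg
        (fun e => jumpWeight_nonneg _ _) hsum (𝒰 := BoxConfigs n N) (h := h) hK hbd
        (fun u hu x _ _ => BoxConfigs.sleep hu x)
        (fun u hu x _ hux y hy => BoxConfigs.jump hu hux hy)
        (fun u x y => if y ∈ box n then h (applyInstr x (.jump y) u) else 0)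
        (fun u x y hy => if_pos hy) (fun u x y hy => (if_neg hy).le) ?_ he n hx
        (add_mul_notMem_box he hx) hu hux
      intro u hu x hx hux
      have hJ : ∀ y, (if y ∈ box n then h (applyInstr x (.jump y) u) else 0) =
          B + stayProb lam P n (applyInstr x (.jump y) u) * (A - B) -
            (if y ∈ box n then G (applyInstr x (.jump y) u) else B) := by
        intro y
        split_ifs with hy
        · rfl
        · rw [stayProb_exit hy]; ring
      rw [hJ, hJ]
      simp only [hh]
      have h1 := hstep u hu x hx hux
      have h2 := mul_le_mul_of_nonneg_right
        (stayProb_step (lam := lam) (n := n) hPt hPn hux) hsub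
      have h3 : sleepWeight lam = 1 - jumpWeight lam P 0 1 - jumpWeight lam P 0 (-1) := by
        linarith
      rw [h3] at h1 h2 ⊢
      linarith
    · push Not at hact
      have h1 := hstable u hu hact
      have h2 : stayProb lam P n u ≤ 1 := avoidProb_le_one u
      have h3 : h u ≤ 0 := by
        simp only [hh]
        nlinarith
      exact h3.trans (mul_nonneg (sub_nonneg.2 (pow_le_one₀ hpos.le hle)) hK)
  set r := 1 - jumpWeight lam P 0 e ^ n with hr
  have hr0 : 0 ≤ r := sub_nonneg.2 (pow_le_one₀ hpos.le hle)
  have hr1 : r < 1 := by have := pow_pos hpos n; linarith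
  -- Iterating the contraction `key` from the bound 1 forces `h ≤ 0`, with no need for almost sure
  -- stabilization.
  have hpow : ∀ m : ℕ, ∀ u ∈ BoxConfigs n N, h u ≤ r ^ m := by
    intro m
    induction m with
    | zero =>
      intro u hu
      have h1 := hB u hu
      have h2 : stayProb lam P n u ≤ 1 := avoidProb_le_one u
      simp only [hh, pow_zero]
      nlinarith
    | succ m ih =>
      intro u hu
      rw [pow_succ']
      exact key _ (pow_nonneg hr0 m) ih u hu
  intro u hu
  exact ge_of_tendsto' (tendsto_pow_atTop_nhds_zero_of_lt_one hr0 hr1) fun m => hpow m u hu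

/-! ### Blocks and block configurations -/

theorem blockIndex_mono {n : ℕ} (hn : 1 ≤ n) {x y : ℤ} (h : x ≤ y) :
    blockIndex n x ≤ blockIndex n y := by
  unfold blockIndex
  exact neg_le_neg (Int.ediv_le_ediv (by omega) (by omega))

theorem blockIndex_add {n : ℕ} (hn : 1 ≤ n) (x k : ℤ) :
    blockIndex n (x + k * n) = blockIndex n x + k := by
  rw [← mem_block_iff hn]
  have := (mem_block_iff hn _ x).2 rfl
  simp only [block, Set.mem_ofPred_eq] at *
  convert this using 1
  ring

/-- Here and below `d = ±1` is a side of the origin, and `d * x` measures the distance to the origin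
on that side. -/
theorem mul_blockIndex_mono {n : ℕ} (hn : 1 ≤ n) {d x y : ℤ} (hd : d = 1 ∨ d = -1)
    (h : d * x ≤ d * y) : d * blockIndex n x ≤ d * blockIndex n y := by
  rcases hd with rfl | rfl
  · have := blockIndex_mono hn (x := x) (y := y) (by omega)
    omega
  · have := blockIndex_mono hn (x := y) (y := x) (by omega)
    omega

theorem abs_blockIndex_sub_le {n : ℕ} (hn : 1 ≤ n) {x y : ℤ} (h : |y - x| ≤ 1) :
    |blockIndex n y - blockIndex n x| ≤ 1 := by
  rw [abs_le] at *
  have h1 := blockIndex_mono hn (x := y) (y := x + 1 * n) (by omega)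
  have h2 := blockIndex_mono hn (x := x + (-1) * n) (y := y) (by omega)
  rw [blockIndex_add hn] at h1 h2
  omega

/-- The configuration of the particles `U` in which the blocks with index in `Z` sleep and the
other blocks are fully active. -/
noncomputable def blockState (n : ℕ) (Z : Set ℤ) (U : Multiset ℤ) : Config := by
  classical exact fun x => if blockIndex n x ∈ Z then
    (if x ∈ U then .sleeping else .active 0) else .active (U.count x)

theorem blockState_of_mem {n : ℕ} {Z : Set ℤ} {U : Multiset ℤ} {x : ℤ} (h : blockIndex n x ∈ Z) :
    blockState n Z U x = if x ∈ U then .sleeping else .active 0 := by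
  simp [blockState, h]

theorem blockState_of_notMem {n : ℕ} {Z : Set ℤ} {U : Multiset ℤ} {x : ℤ}
    (h : blockIndex n x ∉ Z) : blockState n Z U x = .active (U.count x) := by
  simp [blockState, h]

/-- The inequality may be strict: particles of `U` stacked on a site of a sleeping block count as
one. This undercount only raises avoidance probabilities. -/
theorem total_blockState_le {n : ℕ} (Z : Set ℤ) (U : Multiset ℤ) (x : ℤ) :
    (blockState n Z U x).total ≤ U.count x := by
  by_cases h : blockIndex n x ∈ Z
  · rw [blockState_of_mem h]
    split_ifs with hx
    · exact Multiset.one_le_count_iff_mem.2 hx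
    · simp [SiteState.total]
  · rw [blockState_of_notMem h, SiteState.total]

theorem blockState_mono {n : ℕ} {Z Z' : Set ℤ} {U U' : Multiset ℤ} {x : ℤ}
    (hZ : blockIndex n x ∈ Z' → blockIndex n x ∈ Z) (hU : U ≤ U') :
    blockState n Z U x ≤ blockState n Z' U' x := by
  by_cases h' : blockIndex n x ∈ Z'
  · rw [blockState_of_mem (hZ h'), blockState_of_mem h', SiteState.le_def]
    have hmem : x ∈ U → x ∈ U' := fun h => Multiset.mem_of_le hU h
    split_ifs <;> simp_all [SiteState.rank]
  · rw [blockState_of_notMem h']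
    exact SiteState.le_active_of_total_le
      ((total_blockState_le _ _ _).trans (Multiset.count_le_of_le x hU))

/-- The blocks `-L, …, L`. -/
def window (n L : ℕ) : Set ℤ := {x | |blockIndex n x| ≤ L}

/-! ### Moving particles towards the origin -/

/-- Minimum principle for superharmonic sequences. -/
theorem le_of_superharmonic_seq {f : ℕ → ℝ} {s a b : ℝ} (ha : 0 ≤ a) (hb : 0 ≤ b)
    (hs1 : s < 1) (hsum : s + a + b = 1) {R : ℕ}
    (hstep : ∀ i, s * f (i + 1) + a * f (i + 2) + b * f i ≤ f (i + 1))
    (hR : ∀ i, R ≤ i → f 0 ≤ f i) (i : ℕ) : f 0 ≤ f i := by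
  obtain ⟨i₀, -, hmin⟩ := Finset.exists_min_image (Finset.range (R + 1)) f ⟨0, by simp⟩
  have hge : ∀ i, f i₀ ≤ f i := by
    intro i
    by_cases hi : i < R + 1
    · exact hmin i (by simpa using hi)
    · exact (hmin 0 (by simp)).trans (hR i (by omega))
  refine le_trans ?_ (hge i)
  have hs : s = 1 - a - b := by linarith
  subst hs
  -- The minimum propagates upwards until it reaches an index at least `R`, or is already attained
  -- at 0. If `a = 0` then `b > 0`, and it propagates down to 0.
  by_cases ha0 : 0 < a
  · have : ∀ j, f 0 ≤ f i₀ ∨ f (i₀ + j) = f i₀ := by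
      intro j
      induction j with
      | zero => right; rfl
      | succ j ih =>
        rcases ih with ih | ih
        · exact Or.inl ih
        · rcases h : i₀ + j with _ | i
          · left
            rw [h] at ih
            exact ih.le
          · right
            rw [h] at ih
            have h1 := hstep i
            rw [ih] at h1
            have h2 := mul_le_mul_of_nonneg_left (hge i) hb
            have h3 : a * (f (i + 2) - f i₀) ≤ 0 := by linarith
            have h4 : f (i + 2) - f i₀ ≤ 0 := by
              by_contra hc
              exact absurd h3 (not_le.2 (mul_pos ha0 (not_le.1 hc)))
            have h5 := hge (i + 2)
            rw [← add_assoc, h]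
            linarith
    rcases this R with h | h
    · exact h
    · rw [← h]; exact hR _ (by omega)
  · have hb0 : 0 < b := by
      have : a = 0 := le_antisymm (not_lt.1 ha0) ha
      linarith
    have : ∀ i, f i = f i₀ → f 0 ≤ f i₀ := by
      intro i
      induction i with
      | zero => intro h; exact h.le
      | succ i ih =>
        intro h
        refine ih ?_
        have h1 := hstep i
        rw [h] at h1
        have h2 := mul_le_mul_of_nonneg_left (hge (i + 2)) ha
        have h3 : b * (f i - f i₀) ≤ 0 := by linarith
        have h4 : f i - f i₀ ≤ 0 := by
          by_contra hc
          exact absurd h3 (not_le.2 (mul_pos hb0 (not_le.1 hc)))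
        linarith [hge i]
    exact this i₀ rfl

theorem jump_blockState {n : ℕ} {Z : Set ℤ} {U : Multiset ℤ} {x y : ℤ} (hxy : y ≠ x)
    (hx : blockIndex n x ∉ Z) (hy : blockIndex n y ∉ Z) :
    applyInstr x (.jump y) (blockState n Z (x ::ₘ U)) = blockState n Z (y ::ₘ U) := by
  funext z
  rw [applyInstr_apply, siteEffect]
  by_cases hzx : z = x
  · subst hzx
    rw [if_neg hxy.symm, if_pos rfl, blockState_of_notMem hx, blockState_of_notMem hx]
    simp [SiteState.leave, hxy.symm]
  · by_cases hzy : z = y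
    · subst hzy
      rw [if_pos rfl, if_neg hzx, blockState_of_notMem hy, blockState_of_notMem hy]
      simp [SiteState.arrive, hzx]
    · rw [if_neg hzy, if_neg hzx]
      simp [blockState, hzx, hzy]

theorem sleep_le (x : ℤ) (c : Config) (z : ℤ) : applyInstr x .sleep c z ≤ c z := by
  rw [applyInstr_apply, siteEffect]
  split_ifs
  exacts [SiteState.trySleep_le _, le_rfl]

section move

variable {lam : ℝ≥0} {P : ℤ → PMF ℤ} {n L : ℕ}

theorem avoidProb_step (hPt : IsTranslationInvariant P) (hPn : IsNearestNeighbour P) {V S : Set ℤ}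
    {c : Config} {x : ℤ} (hxS : x ∉ S) (hx : c x ≠ .active 0) :
    sleepWeight lam * avoidProb lam P V S (applyInstr x .sleep c) +
      jumpWeight lam P 0 1 * avoidProb lam P V S (applyInstr x (.jump (x + 1)) c) +
      jumpWeight lam P 0 (-1) * avoidProb lam P V S (applyInstr x (.jump (x + -1)) c) ≤
        avoidProb lam P V S c := by
  rw [← jumpWeight_translate hPt x 1, ← jumpWeight_translate hPt x (-1)]
  refine le_of_eq_of_le ?_ (integral_le_avoidProb hxS hx)
  exact (integral_instrPMF hPn x (f := fun ι => avoidProb lam P V S (applyInstr x ι c))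
    (fun _ => avoidProb_nonneg _) fun _ => avoidProb_le_one _).symm

theorem notMem_window {x : ℤ} (hn : 1 ≤ n) (hx : (L : ℤ) * n + n < |x|) : x ∉ window n L := by
  intro h
  have h1 := (mem_block_iff hn _ x).2 rfl
  simp only [window, block, box, Set.mem_ofPred_eq] at h h1
  rw [abs_le] at h
  have h2 : blockIndex n x * n ≤ L * n := mul_le_mul_of_nonneg_right h.2 (by omega)
  have h3 : -(L * n : ℤ) ≤ blockIndex n x * n := by
    rw [← neg_mul]; exact mul_le_mul_of_nonneg_right h.1 (by omega)
  rcases abs_cases x with ⟨h4, -⟩ | ⟨h4, -⟩ <;> omega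

/-- Moving an active particle towards the origin decreases the probability to avoid the block of
the origin. -/
theorem avoidProb_move (hPt : IsTranslationInvariant P) (hPn : IsNearestNeighbour P) (hn : 1 ≤ n)
    {Z : Set ℤ} {U : Multiset ℤ} {d x y : ℤ} (hd : d = 1 ∨ d = -1) (hxy : d * y ≤ d * x)
    (hy : 1 ≤ d * blockIndex n y) (hZ : ∀ j, d * blockIndex n y ≤ d * j → j ∉ Z) :
    avoidProb lam P (window n L) (block n 0) (blockState n Z (y ::ₘ U)) ≤
      avoidProb lam P (window n L) (block n 0) (blockState n Z (x ::ₘ U)) := by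
  set F := avoidProb lam P (window n L) (block n 0) with hF
  -- The avoidance probability with the particle `i` steps farther from the origin than `y`.
  let f : ℕ → ℝ := fun i => F (blockState n Z ((y + d * i) ::ₘ U))
  have hdd : d * d = 1 := by rcases hd with rfl | rfl <;> rfl
  have hbi : ∀ i : ℕ, d * blockIndex n y ≤ d * blockIndex n (y + d * i) := fun i =>
    mul_blockIndex_mono hn hd (by rw [mul_add, ← mul_assoc, hdd]; omega)
  -- A particle outside the window is never seen, so `f` is maximal there.
  have hout : ∀ i j, y + d * (i : ℕ) ∉ window n L → f j ≤ f i := by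
    intro i j hi
    have h1 : f j ≤ F (blockState n Z U) :=
      avoidProb_anti fun z _ => blockState_mono id (Multiset.le_cons_self _ _)
    refine h1.trans (avoidProb_anti fun z hz => ?_)
    have hzi : z ≠ y + d * i := by rintro rfl; exact hi hz
    simp [blockState, hzi]
  have hsum := sum_weights (lam := lam) hPn 0
  simp only [zero_add] at hsum
  have hstep : ∀ i, sleepWeight lam * f (i + 1) + jumpWeight lam P 0 d * f (i + 2) +
      jumpWeight lam P 0 (-d) * f i ≤ f (i + 1) := by
    intro i
    obtain ⟨z, hz⟩ : ∃ z, z = y + d * ((i + 1 : ℕ) : ℤ) := ⟨_, rfl⟩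
    have hbz := hbi (i + 1)
    rw [← hz] at hbz
    by_cases hzV : z ∈ window n L
    · have hzS : z ∉ block n 0 := by
        rw [mem_block_iff hn]
        intro h0
        rw [h0] at hbz
        omega
      have hne : blockState n Z (z ::ₘ U) z ≠ .active 0 := by
        rw [blockState_of_notMem (hZ _ hbz)]
        simp
      have h1 := avoidProb_step (lam := lam) (V := window n L) hPt hPn hzS hne
      rw [← hF] at h1
      have h4 : F (blockState n Z (z ::ₘ U)) = f (i + 1) := by rw [hz]
      -- A sleep attempt can only lower the configuration, hence raises the avoidance probability.
      have h2 : f (i + 1) ≤ F (applyInstr z .sleep (blockState n Z (z ::ₘ U))) :=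
        h4 ▸ avoidProb_anti fun w _ => sleep_le _ _ _
      have hup : F (applyInstr z (.jump (z + d)) (blockState n Z (z ::ₘ U))) = f (i + 2) := by
        have e : z + d = y + d * ((i + 2 : ℕ) : ℤ) := by rw [hz]; push_cast; ring
        rw [jump_blockState (by rcases hd with h | h <;> omega) (hZ _ hbz)
          (by rw [e]; exact hZ _ (hbi (i + 2))), e]
      have hdown : F (applyInstr z (.jump (z + -d)) (blockState n Z (z ::ₘ U))) = f i := by
        have e : z + -d = y + d * (i : ℤ) := by rw [hz]; push_cast; ring
        rw [jump_blockState (by rcases hd with h | h <;> omega) (hZ _ hbz)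
          (by rw [e]; exact hZ _ (hbi i)), e]
      have h3 := mul_le_mul_of_nonneg_left h2 (sleepWeight_nonneg (lam := lam))
      rw [h4] at h1
      rcases hd with rfl | rfl
      · rw [hup, hdown] at h1
        linarith
      · rw [hup] at h1
        rw [neg_neg] at hdown ⊢
        rw [hdown] at h1
        linarith
    · have h1 := hout (i + 1) (i + 2) (hz ▸ hzV)
      have h2 := hout (i + 1) i (hz ▸ hzV)
      have h3 := mul_le_mul_of_nonneg_left h1 (jumpWeight_nonneg (lam := lam) (P := P) 0 d)
      have h4 := mul_le_mul_of_nonneg_left h2 (jumpWeight_nonneg (lam := lam) (P := P) 0 (-d))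
      have h5 : sleepWeight lam = 1 - jumpWeight lam P 0 d - jumpWeight lam P 0 (-d) := by
        rcases hd with rfl | rfl
        · linarith
        · rw [neg_neg]; linarith
      rw [h5]
      linarith
  -- Beyond this distance the particle is certainly outside the window.
  have hlim : ∀ i, (|y| + L * n + n + 1).toNat ≤ i → f 0 ≤ f i := by
    intro i hi
    refine hout i 0 (notMem_window hn ?_)
    have : |y| + L * n + n + 1 ≤ (i : ℤ) := by omega
    have h2 : |d * (i : ℤ)| = i := by rcases hd with rfl | rfl <;> simp
    have h3 := abs_sub_abs_le_abs_sub (d * (i : ℤ)) (-y)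
    rw [h2, abs_neg, show d * (i : ℤ) - -y = y + d * i by ring] at h3
    omega
  have := le_of_superharmonic_seq (jumpWeight_nonneg _ _) (jumpWeight_nonneg _ _)
    sleepWeight_lt_one (by
      rcases hd with rfl | rfl
      · exact hsum
      · rw [neg_neg]; linarith) hstep hlim (d * (x - y)).toNat
  have h0 : 0 ≤ d * (x - y) := by rw [mul_sub]; omega
  have hx : y + d * (((d * (x - y)).toNat : ℕ) : ℤ) = x := by
    rw [Int.toNat_of_nonneg h0, ← mul_assoc, hdd]; ring
  simpa only [f, hx, Nat.cast_zero, mul_zero, add_zero] using this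

/-- One particle at a time, with an arbitrary matching: all of `M` is at least as far as all of
`M'`. -/
theorem avoidProb_move_multiset (hPt : IsTranslationInvariant P) (hPn : IsNearestNeighbour P)
    (hn : 1 ≤ n) {Z : Set ℤ} {U M M' : Multiset ℤ} {d : ℤ} (hd : d = 1 ∨ d = -1)
    (hcard : M.card = M'.card) (hM : ∀ x ∈ M, ∀ y ∈ M', d * y ≤ d * x)
    (hM' : ∀ y ∈ M', 1 ≤ d * blockIndex n y)
    (hZ : ∀ y ∈ M', ∀ j, d * blockIndex n y ≤ d * j → j ∉ Z) :
    avoidProb lam P (window n L) (block n 0) (blockState n Z (U + M')) ≤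
      avoidProb lam P (window n L) (block n 0) (blockState n Z (U + M)) := by
  induction M' using Multiset.induction_on generalizing M U with
  | empty => rw [Multiset.card_zero, Multiset.card_eq_zero] at hcard; rw [hcard]
  | cons y M' ih =>
    obtain ⟨x, hx⟩ := Multiset.card_pos_iff_exists_mem.1
      (show 0 < M.card by rw [hcard, Multiset.card_cons]; omega)
    obtain ⟨M, rfl⟩ := Multiset.exists_cons_of_mem hx
    have h1 := avoidProb_move (lam := lam) (L := L) hPt hPn hn (U := U + M) hd
      (hM x (by simp) y (by simp)) (hM' y (by simp)) (hZ y (by simp))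
    have h2 := ih (M := M) (U := y ::ₘ U) (by simpa using hcard)
      (fun x hx z hz => hM x (by simp [hx]) z (by simp [hz]))
      (fun z hz => hM' z (by simp [hz])) (fun z hz => hZ z (by simp [hz]))
    rw [Multiset.cons_add, Multiset.cons_add] at h2
    rw [Multiset.add_cons, Multiset.add_cons]
    exact h2.trans h1

end move

/-! ### Stabilization of one copy of `η` -/

/-- The copy of `η` in the block number `k`, as a multiset of positions. -/
noncomputable def copyAt {n : ℕ} (η : box n → ℕ) (k : ℤ) : Multiset ℤ :=
  ∑ x ∈ Finset.Icc (-(n : ℤ)) n, Multiset.replicate (extendZero η x) (x + k * n)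

theorem mem_Icc_of_mem_box {n : ℕ} {x : ℤ} (hx : x ∈ box n) : x ∈ Finset.Icc (-(n : ℤ)) n := by
  simp only [box, Set.mem_ofPred_eq] at hx
  rw [Finset.mem_Icc]
  omega

theorem count_copyAt {n : ℕ} (η : box n → ℕ) (k z : ℤ) :
    (copyAt η k).count z = extendZero η (z - k * n) := by
  rw [copyAt, Multiset.count_sum']
  rw [Finset.sum_eq_single (z - k * n)]
  · simp
  · intro x _ hx
    rw [Multiset.count_replicate, if_neg]
    omega
  · intro hz
    have : z - k * n ∉ box n := fun h => hz (mem_Icc_of_mem_box h)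
    simp [extendZero, this]

theorem card_copyAt {n : ℕ} (η : box n → ℕ) (k : ℤ) :
    (copyAt η k).card = ∑ x ∈ Finset.Icc (-(n : ℤ)) n, extendZero η x := by
  simp [copyAt]

theorem blockIndex_of_mem_copyAt {n : ℕ} (hn : 1 ≤ n) {η : box n → ℕ} {k z : ℤ}
    (hz : z ∈ copyAt η k) : blockIndex n z = k := by
  rw [← mem_block_iff hn]
  by_contra h
  rw [← Multiset.count_pos, count_copyAt] at hz
  change z - k * n ∉ box n at h
  simp [extendZero, h] at hz

open Classical in
/-- Replacing the block number `k` of `c` by `u`. -/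
noncomputable def placeBlock (n : ℕ) (k : ℤ) (u c : Config) : Config := fun x =>
  if blockIndex n x = k then u (x - k * n) else c x

theorem placeBlock_sleep {n : ℕ} (hn : 1 ≤ n) {k : ℤ} {u c : Config} {x : ℤ} (hx : x ∈ box n) :
    applyInstr (x + k * n) .sleep (placeBlock n k u c) =
      placeBlock n k (applyInstr x .sleep u) c := by
  have hxk : blockIndex n (x + k * n) = k := by
    rw [← mem_block_iff hn]; simpa [block] using hx
  funext z
  by_cases hz : blockIndex n z = k
  · by_cases hzx : z = x + k * n
    · subst hzx
      simp [applyInstr_apply, siteEffect, placeBlock, hz]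
    · have : z - k * n ≠ x := fun h => hzx (by omega)
      simp [applyInstr_apply, siteEffect, placeBlock, hz, hzx, this]
  · have hzx : z ≠ x + k * n := by rintro rfl; exact hz hxk
    simp [applyInstr_apply, siteEffect, placeBlock, hz, hzx]

theorem placeBlock_jump {n : ℕ} (hn : 1 ≤ n) {k : ℤ} {u c : Config} {x y : ℤ} (hx : x ∈ box n)
    (hy : y ∈ box n) : applyInstr (x + k * n) (.jump (y + k * n)) (placeBlock n k u c) =
      placeBlock n k (applyInstr x (.jump y) u) c := by
  have hxk : ∀ x ∈ box n, blockIndex n (x + k * n) = k := by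
    intro x hx
    rw [← mem_block_iff hn]; simpa [block] using hx
  funext z
  by_cases hz : blockIndex n z = k
  · have h1 : ∀ x, z = x + k * n ↔ z - k * n = x := by intro x; omega
    simp [applyInstr_apply, siteEffect, placeBlock, hz, h1]
  · have hzx : ∀ x ∈ box n, z ≠ x + k * n := by
      rintro x hx rfl; exact hz (hxk x hx)
    simp [applyInstr_apply, siteEffect, placeBlock, hz, hzx x hx, hzx y hy]

theorem total_placeBlock_le {n : ℕ} {k : ℤ} {u : Config} {M : Multiset ℤ} (hu : Carries u M)
    (Z : Set ℤ) (U : Multiset ℤ) (x : ℤ) :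
    (placeBlock n k u (blockState n Z U) x).total ≤ (U + M.map (· + k * n)).count x := by
  rw [Multiset.count_add]
  unfold placeBlock
  split_ifs with h
  · have h1 := Multiset.count_map_eq_count' (· + k * (n : ℤ)) M (add_left_injective _) (x - k * n)
    simp only [sub_add_cancel] at h1
    rw [h1, hu]
    omega
  · have := total_blockState_le (n := n) Z U x
    omega

theorem count_map_add (M : Multiset ℤ) (t x : ℤ) : (M.map (· + t)).count x = M.count (x - t) := by
  have h1 := Multiset.count_map_eq_count' (· + t) M (add_left_injective _) (x - t)
  simpa only [sub_add_cancel] using h1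

theorem placeBlock_le {n : ℕ} {k : ℤ} {u : Config} {M U : Multiset ℤ} (hu : Carries u M)
    {Z Z' : Set ℤ} (hZ : Z' ⊆ Z) (hk : k ∉ Z') (x : ℤ) :
    placeBlock n k u (blockState n Z U) x ≤ blockState n Z' (U + M.map (· + k * n)) x := by
  by_cases hx : blockIndex n x ∈ Z'
  · have : blockIndex n x ≠ k := by rintro h; exact hk (h ▸ hx)
    simp only [placeBlock, if_neg this]
    exact blockState_mono (fun h => hZ h) (Multiset.le_add_right _ _)
  · rw [blockState_of_notMem hx]
    exact SiteState.le_active_of_total_le (total_placeBlock_le hu Z U x)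

section

variable {lam : ℝ≥0} {P : ℤ → PMF ℤ} {n L : ℕ}

/-- Stabilization of a copy of `η` in the block number `k`. -/
theorem avoidProb_copyAt (hPt : IsTranslationInvariant P) (hPn : IsNearestNeighbour P)
    (hn : 1 ≤ n) {η : box n → ℕ} {Z Z' : Set ℤ} {U : Multiset ℤ} {k : ℤ}
    (hU : ∀ x ∈ U, blockIndex n x ≠ k) (hk0 : k ≠ 0) (hkZ : k ∉ Z) (hZ : Z' ⊆ Z)
    (hZ' : ∀ j, |j - k| ≤ 1 → j ∉ Z') {A B : ℝ} (hBA : B ≤ A) (hA : A - B ≤ 1)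
    (hstable : ∀ M : Multiset ℤ, M.card = (copyAt η k).card → (∀ x ∈ M, blockIndex n x = k) →
      A ≤ avoidProb lam P (window n L) (block n 0) (blockState n (insert k Z) (U + M)))
    (hmove : ∀ M : Multiset ℤ, M.card = (copyAt η k).card →
      (∀ x ∈ M, ∃ y, blockIndex n y = k ∧ |x - y| ≤ 1) →
      B ≤ avoidProb lam P (window n L) (block n 0) (blockState n Z' (U + M))) :
    B + probNoExit lam P n η * (A - B) ≤
      avoidProb lam P (window n L) (block n 0) (blockState n Z (U + copyAt η k)) := by
  classical
  have hxk : ∀ x ∈ box n, blockIndex n (x + k * n) = k := by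
    intro x hx
    rw [← mem_block_iff hn]; simpa [block] using hx
  have hkZ' : k ∉ Z' := hZ' k (by simp)
  set F := avoidProb lam P (window n L) (block n 0) with hF
  set N := (copyAt η k).card with hN
  let G : Config → ℝ := fun u => F (placeBlock n k u (blockState n Z U))
  have hstart : placeBlock n k (allActive (extendZero η)) (blockState n Z U) =
      blockState n Z (U + copyAt η k) := by
    funext x
    by_cases hx : blockIndex n x = k
    · rw [blockState_of_notMem (by rwa [hx])]
      have : U.count x = 0 := Multiset.count_eq_zero.2 fun h => hU x h hx
      simp [placeBlock, hx, allActive, this, count_copyAt]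
    · have hc : x ∉ copyAt η k := fun h => hx (blockIndex_of_mem_copyAt hn h)
      simp [placeBlock, hx, blockState, hc]
  have hmem : allActive (extendZero η) ∈ BoxConfigs n N := by
    refine ⟨copyAt η 0, by rw [hN, card_copyAt, card_copyAt], fun x hx => ?_, fun x => ?_⟩
    · have := (mem_block_iff hn 0 x).2 (blockIndex_of_mem_copyAt hn hx)
      simpa [block] using this
    · simp [count_copyAt, allActive, SiteState.total]
  have hmain : B + stayProb lam P n (allActive (extendZero η)) * (A - B) ≤
      G (allActive (extendZero η)) := by
    refine le_of_superharmonic hPt hPn hBA hA ?_ ?_ ?_ hmem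
    -- The lower bound `B` holds at all times: waking everything in block `k` and the blocks outside
    -- `Z'` lowers the avoidance probability.
    · rintro u ⟨M, hM, hMb, hu⟩
      refine (hmove (M.map (· + k * n)) (by simpa using hM) ?_).trans
        (avoidProb_anti fun x _ => placeBlock_le hu hZ hkZ' x)
      simp only [Multiset.mem_map]
      rintro _ ⟨x, hx, rfl⟩
      exact ⟨x + k * n, hxk x (hMb x hx), by simp⟩
    · rintro u ⟨M, hM, hMb, hu⟩ hst
      refine (hstable (M.map (· + k * n)) (by simpa using hM) ?_).trans
        (avoidProb_anti fun x _ => ?_)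
      · simp only [Multiset.mem_map]
        rintro _ ⟨x, hx, rfl⟩
        exact hxk x (hMb x hx)
      -- In a stable state each site of the block is empty or holds one sleeper, as in a sleeping
      -- block.
      · by_cases hx : blockIndex n x = k
        · rw [blockState_of_mem (by simp [hx])]
          simp only [placeBlock, if_pos hx]
          rw [SiteState.eq_of_not_isActive (hst _), hu]
          by_cases h0 : M.count (x - k * n) = 0
          · rw [if_pos h0]; split_ifs <;> simp [SiteState.le_def, SiteState.rank]
          · rw [if_neg h0, if_pos]
            rw [← count_map_add, Multiset.count_eq_zero, not_not] at h0
            exact Multiset.mem_add.2 (Or.inr h0)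
        · simp only [placeBlock, if_neg hx]
          exact blockState_mono (by simp [hx]) (Multiset.le_add_right _ _)
    · rintro u hu x hx hux
      have hbi := hxk x hx
      have hS : x + k * n ∉ block n 0 := by
        rw [mem_block_iff hn, hbi]; exact hk0
      have hne : placeBlock n k u (blockState n Z U) (x + k * n) ≠ .active 0 := by
        simp only [placeBlock, hbi, if_true, add_sub_cancel_right]
        exact hux.ne_empty
      refine le_trans ?_ (avoidProb_step (lam := lam) (V := window n L) hPt hPn hS hne)
      have hJ : ∀ e : ℤ, |e| ≤ 1 → (if x + e ∈ box n then G (applyInstr x (.jump (x + e)) u)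
          else B) ≤ F (applyInstr (x + k * n) (.jump (x + k * n + e))
            (placeBlock n k u (blockState n Z U))) := by
        intro e he
        rw [show x + k * n + e = (x + e) + k * n by ring]
        split_ifs with hy
        · rw [placeBlock_jump hn hx hy]
        · obtain ⟨M, hM, hMb, hu⟩ := hu
          have hxM := hu.mem hux
          refine (hmove (((x + e) ::ₘ M.erase x).map (· + k * n)) ?_ ?_).trans
            (avoidProb_anti fun z _ => ?_)
          · rw [Multiset.card_map, Multiset.card_cons, Multiset.card_erase_add_one hxM, hM]
          · simp only [Multiset.mem_map, Multiset.mem_cons]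
            rintro _ ⟨z, rfl | hz, rfl⟩
            · exact ⟨x + k * n, hbi, by simpa using he⟩
            · exact ⟨z + k * n, hxk z (hMb z (Multiset.mem_of_mem_erase hz)), by simp⟩
          -- The exiting particle lands in block `k` or an adjacent one, awake in `Z'`.
          · have hyk : ∀ z, z = x + e + k * n → blockIndex n z ∉ Z' := by
              rintro z rfl
              refine hZ' _ ?_
              have := abs_blockIndex_sub_le hn (x := x + k * n) (y := x + e + k * n) (by
                rwa [show x + e + k * n - (x + k * n) = e by ring])
              rwa [hbi] at this
            have htot := total_placeBlock_le (n := n) (k := k) hu Z U z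
            have hcount : (((x + e) ::ₘ M.erase x).map (· + k * (n : ℤ))).count z =
                ((M.map (· + k * (n : ℤ))).count z - if z = x + k * n then 1 else 0) +
                  if z = x + e + k * n then 1 else 0 := by
              rw [count_map_add, count_map_add, Multiset.count_cons]
              have h1 : z - k * n = x + e ↔ z = x + e + k * n := by omega
              have h2 : z = x + k * n ↔ z - k * n = x := by omega
              simp only [h1, h2]
              congr 1
              by_cases h3 : z - k * n = x
              · rw [h3]; simp
              · simp [h3]
            have hpos : z = x + k * n → U.count z = 0 := by
              rintro rfl
              exact Multiset.count_eq_zero.2 fun h => hU _ h hbi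
            rw [applyInstr_apply, siteEffect]
            by_cases hzZ : blockIndex n z ∈ Z'
            · have hzy : z ≠ x + e + k * n := fun h => hyk z h hzZ
              have hzk : blockIndex n z ≠ k := fun h => hkZ' (h ▸ hzZ)
              have hzx : z ≠ x + k * n := fun h => hzk (h ▸ hbi)
              rw [if_neg hzy, if_neg hzx]
              simp only [placeBlock, if_neg hzk]
              exact blockState_mono (fun h => hZ h) (Multiset.le_add_right _ _)
            · rw [blockState_of_notMem hzZ]
              refine SiteState.le_active_of_total_le ?_
              rw [Multiset.count_add, hcount]
              rw [Multiset.count_add] at htot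
              split_ifs <;> simp_all [SiteState.total_arrive, SiteState.total_leave]
              all_goals omega
      have h1 := mul_le_mul_of_nonneg_left (hJ 1 (by simp))
        (jumpWeight_nonneg (lam := lam) (P := P) 0 1)
      have h2 := mul_le_mul_of_nonneg_left (hJ (-1) (by simp))
        (jumpWeight_nonneg (lam := lam) (P := P) 0 (-1))
      rw [placeBlock_sleep hn hx]
      linarith
  have h1 := mul_le_mul_of_nonneg_right (probNoExit_le_stayProb (lam := lam) (P := P) η)
    (sub_nonneg.2 hBA)
  simp only [G, hstart] at hmain
  linarith

end

/-! ### Topplings and potential of the coarse-grained model -/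

theorem exists_le_card_eq {α : Type*} (s : Multiset α) {m : ℕ} (h : m ≤ s.card) :
    ∃ t ≤ s, t.card = m := by
  have : 0 < (Multiset.powersetCard m s).card := by
    rw [Multiset.card_powersetCard]; exact Nat.choose_pos h
  obtain ⟨t, ht⟩ := Multiset.card_pos_iff_exists_mem.1 this
  exact ⟨t, Multiset.mem_powersetCard.1 ht⟩

/-- Off the origin the jump towards it takes all the mass not given to sleep. -/
theorem avoidProb_directed {lam : ℝ≥0} {D : ℤ → PMF ℤ} (hDn : IsNearestNeighbour D)
    (hDo : IsDirectedToOrigin D) {V S : Set ℤ} {c : Config} {d k : ℤ} (hd : d = 1 ∨ d = -1)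
    (hk : 1 ≤ d * k) (hkV : k ∈ V) (hc : (c k).IsActive) :
    avoidProb lam D V S c ≤ sleepWeight lam * avoidProb lam D V S (applyInstr k .sleep c) +
      (1 - sleepWeight lam) * avoidProb lam D V S (applyInstr k (.jump (k - d)) c) := by
  have hsum := sum_weights (lam := lam) hDn k
  have h1 := avoidProb_le_integral (lam := lam) (P := D) (S := S) hkV hc
  rw [integral_instrPMF hDn k (f := fun ι => avoidProb lam D V S (applyInstr k ι c))
    (fun _ => avoidProb_nonneg _) (fun _ => avoidProb_le_one _)] at h1
  have hw : sleepWeight lam = 1 - 1 / (1 + lam) := by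
    have : (0 : ℝ) < 1 + lam := by positivity
    unfold sleepWeight
    field_simp
    ring
  rcases hd with rfl | rfl
  · have h2 : jumpWeight lam D k (k + -1) = 1 / (1 + lam) := by
      have := (hDo k (by omega)).1
      rw [jumpWeight, ← sub_eq_add_neg, this]
      simp
    have h3 : jumpWeight lam D k (k + 1) = 0 := by linarith
    rw [h3, h2] at h1
    rw [sub_eq_add_neg k]
    refine h1.trans_eq ?_
    rw [hw]
    ring
  · have h2 : jumpWeight lam D k (k + 1) = 1 / (1 + lam) := by
      have := (hDo (-k) (by omega)).2
      rw [neg_neg] at this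
      rw [jumpWeight, this]
      simp
    have h3 : jumpWeight lam D k (k + -1) = 0 := by linarith
    rw [h3, h2] at h1
    rw [sub_neg_eq_add]
    refine h1.trans_eq ?_
    rw [hw]
    ring

/-- The set of sleeping sites. -/
def sleepers (c : Config) : Set ℤ := {k | c k = .sleeping}

/-- The contribution of the site `k` to the potential of the coarse-grained model. -/
def potentialAt (k : ℤ) : SiteState → ℕ
  | .active a => a * (2 * k.natAbs + 1)
  | .sleeping => 2 * k.natAbs

/-- A quantity which decreases when the particles move towards the origin or fall asleep. -/
noncomputable def potential (L : ℕ) (c : Config) : ℕ :=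
  ∑ k ∈ Finset.Icc (-(L : ℤ)) L, potentialAt k (c k)

theorem mem_Icc_iff_abs_le {L : ℕ} {k : ℤ} : k ∈ Finset.Icc (-(L : ℤ)) L ↔ |k| ≤ (L : ℤ) := by
  rw [Finset.mem_Icc, abs_le]

theorem potential_sleep_lt {L : ℕ} {c : Config} {k : ℤ} (hk : |k| ≤ (L : ℤ)) (hc : c k = .active 1) :
    potential L (applyInstr k .sleep c) < potential L c := by
  refine Finset.sum_lt_sum (fun i _ => ?_) ⟨k, mem_Icc_iff_abs_le.2 hk, ?_⟩
  · by_cases hi : i = k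
    · subst hi
      simp [applyInstr_apply, siteEffect, hc, SiteState.trySleep, potentialAt]
    · simp [applyInstr_apply, siteEffect, hi]
  · simp [applyInstr_apply, siteEffect, hc, SiteState.trySleep, potentialAt]

/-- One step towards the origin gains 2, while waking a sleeper costs only 1. -/
theorem potential_jump_lt {L : ℕ} {c : Config} {d k : ℤ} (hd : d = 1 ∨ d = -1) (hdk : 1 ≤ d * k)
    (hk : |k| ≤ (L : ℤ)) (hc : (c k).IsActive) :
    potential L (applyInstr k (.jump (k - d)) c) < potential L c := by
  have hne : k - d ≠ k := by rcases hd with rfl | rfl <;> omega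
  have hk' : k ∈ Finset.Icc (-(L : ℤ)) L := mem_Icc_iff_abs_le.2 hk
  have hj' : k - d ∈ (Finset.Icc (-(L : ℤ)) L).erase k := by
    refine Finset.mem_erase.2 ⟨hne, ?_⟩
    rw [Finset.mem_Icc] at *
    rcases hd with rfl | rfl <;> omega
  unfold potential
  rw [← Finset.add_sum_erase _ _ hk', ← Finset.add_sum_erase _ _ hj',
    ← Finset.add_sum_erase _ _ hk', ← Finset.add_sum_erase _ _ hj', ← add_assoc, ← add_assoc]
  have hrest : ∑ i ∈ ((Finset.Icc (-(L : ℤ)) L).erase k).erase (k - d),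
      potentialAt i (applyInstr k (.jump (k - d)) c i) =
      ∑ i ∈ ((Finset.Icc (-(L : ℤ)) L).erase k).erase (k - d), potentialAt i (c i) := by
    refine Finset.sum_congr rfl fun i hi => ?_
    have h1 := Finset.ne_of_mem_erase hi
    have h2 := Finset.ne_of_mem_erase (Finset.mem_of_mem_erase hi)
    simp [applyInstr_apply, siteEffect, h1, h2]
  rw [hrest]
  refine Nat.add_lt_add_right ?_ _
  simp only [applyInstr_apply, siteEffect, if_neg hne, if_neg hne.symm, if_true]
  have habs : k.natAbs = (k - d).natAbs + 1 := by rcases hd with rfl | rfl <;> omega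
  rcases hck : c k with (_ | a) | _
  · simp [hck, SiteState.IsActive] at hc
  · rcases c (k - d) with b | _ <;>
      simp only [SiteState.leave, SiteState.arrive, potentialAt, Nat.add_sub_cancel, habs] <;>
      generalize (k - d).natAbs = q <;>
      ring_nf <;> omega
  · simp [hck, SiteState.IsActive] at hc

/-! ### Compatibility of coarse and block configurations -/

/-- The coarse-grained configuration `c` describes the block configuration with particles `U` in
which the blocks in `sleepers c` sleep. -/
structure Compatible {n : ℕ} (η : box n → ℕ) (L : ℕ) (c : Config) (U : Multiset ℤ) : Prop where
  origin : c 0 = .active 0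
  sorted : ∀ d : ℤ, (d = 1 ∨ d = -1) → ∀ i j, 1 ≤ d * i → d * i < d * j → (c i).IsActive →
    c j ≠ .sleeping
  card : ∀ k, |k| ≤ (L : ℤ) →
    (U.filter (blockIndex n · = k)).card = (copyAt η 0).card * (c k).total
  copy : ∀ k, |k| ≤ (L : ℤ) → (c k).IsActive → copyAt η k ≤ U

theorem filter_eq_self_of_block {n : ℕ} {M : Multiset ℤ} {k : ℤ}
    (hM : ∀ x ∈ M, blockIndex n x = k) (i : ℤ) :
    (M.filter (blockIndex n · = i)).card = if i = k then M.card else 0 := by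
  split_ifs with h
  · subst h; rw [Multiset.filter_eq_self.2 hM]
  · rw [Multiset.card_eq_zero, Multiset.filter_eq_nil]
    intro x hx hxi
    exact h (hxi ▸ hM x hx)

theorem card_copyAt_eq {n : ℕ} (η : box n → ℕ) (k : ℤ) :
    (copyAt η k).card = (copyAt η 0).card := by rw [card_copyAt, card_copyAt]

section

variable {n L : ℕ} {η : box n → ℕ} {c : Config} {U : Multiset ℤ}

/-- `U₀` stands for `U` with `|η|` particles of block `k` removed. The order is kept because the
only possible new active site is `k - d`, and no site beyond the active site `k` was asleep. -/
theorem Compatible.jump (hn : 1 ≤ n) {U₀ : Multiset ℤ} {d k : ℤ} (h : Compatible η L c U)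
    (hd : d = 1 ∨ d = -1) (hdk : 1 ≤ d * k) (hj : k - d ≠ 0) (hc : (c k).IsActive)
    (hcard : ∀ i, |i| ≤ (L : ℤ) → (U₀.filter (blockIndex n · = i)).card =
      (copyAt η 0).card * if i = k then (c i).total - 1 else (c i).total)
    (hcopy : ∀ i, |i| ≤ (L : ℤ) → (c i).IsActive → (i = k → 2 ≤ (c k).total) → copyAt η i ≤ U₀) :
    Compatible η L (applyInstr k (.jump (k - d)) c) (U₀ + copyAt η (k - d)) := by
  have hne : k - d ≠ k := by rcases hd with rfl | rfl <;> omega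
  have hk0 : k ≠ 0 := by rintro rfl; simp at hdk
  have hval : ∀ i, i ≠ k → i ≠ k - d → applyInstr k (.jump (k - d)) c i = c i := by
    intro i h1 h2
    simp [applyInstr_apply, siteEffect, h1, h2]
  have hvalk : applyInstr k (.jump (k - d)) c k = (c k).leave := by
    simp [applyInstr_apply, siteEffect, hne.symm]
  have hvalj : applyInstr k (.jump (k - d)) c (k - d) = (c (k - d)).arrive := by
    simp [applyInstr_apply, siteEffect, hne]
  refine ⟨?_, ?_, ?_, ?_⟩
  · rw [hval 0 hk0.symm hj.symm, h.origin]
  · intro e he i j hi hij hact hsl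
    have hjk : j ≠ k := by
      rintro rfl
      rw [hvalk] at hsl
      rcases h' : c j with a | _ <;> rw [h'] at hsl <;> simp [SiteState.leave] at hsl
    have hjj : j ≠ k - d := by
      rintro rfl
      rw [hvalj] at hsl
      rcases h' : c (k - d) with a | _ <;> rw [h'] at hsl <;> simp [SiteState.arrive] at hsl
    rw [hval j hjk hjj] at hsl
    by_cases hik : i = k
    · subst hik
      exact h.sorted e he i j hi hij hc hsl
    · by_cases hii : i = k - d
      · have hed : e = d := by
          rcases hd with rfl | rfl <;> rcases he with rfl | rfl <;> first | rfl | omega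
        subst hed
        refine h.sorted e he k j hdk ?_ hc hsl
        rcases he with rfl | rfl <;> omega
      · rw [hval i hik hii] at hact
        exact h.sorted e he i j hi hij hact hsl
  · intro i hi
    rw [Multiset.filter_add, Multiset.card_add, hcard i hi,
      filter_eq_self_of_block (fun x hx => blockIndex_of_mem_copyAt hn hx),
      card_copyAt_eq η (k - d)]
    by_cases hik : i = k
    · subst hik
      rw [hvalk, SiteState.total_leave]
      simp [hne.symm]
    · by_cases hii : i = k - d
      · subst hii
        rw [hvalj, SiteState.total_arrive]
        simp [hne, mul_add]
      · rw [hval i hik hii]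
        simp [hik, hii]
  · intro i hi hact
    by_cases hii : i = k - d
    · subst hii
      exact Multiset.le_add_left _ _
    · refine le_trans ?_ (Multiset.le_add_right _ _)
      by_cases hik : i = k
      · subst hik
        refine hcopy i hi hc fun _ => ?_
        rw [hvalk] at hact
        have := hact.total_pos
        rw [SiteState.total_leave] at this
        omega
      · rw [hval i hik hii] at hact
        exact hcopy i hi hact fun h => absurd h hik

/-- The order is kept because no active site is nearer to the origin than the new sleeper `k`. -/
theorem Compatible.sleep {U₀ M : Multiset ℤ} {k : ℤ} (h : Compatible η L c U)
    (hk0 : k ≠ 0) (hc : c k = .active 1)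
    (hmin : ∀ i, (c i).IsActive → |k| ≤ |i|)
    (hM : M.card = (copyAt η 0).card) (hMk : ∀ x ∈ M, blockIndex n x = k)
    (hcard : ∀ i, |i| ≤ (L : ℤ) → (U₀.filter (blockIndex n · = i)).card =
      (copyAt η 0).card * if i = k then (c i).total - 1 else (c i).total)
    (hcopy : ∀ i, |i| ≤ (L : ℤ) → (c i).IsActive → (i = k → 2 ≤ (c k).total) → copyAt η i ≤ U₀) :
    Compatible η L (applyInstr k .sleep c) (U₀ + M) := by
  have hval : ∀ i, i ≠ k → applyInstr k .sleep c i = c i := by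
    intro i h1
    simp [applyInstr_apply, siteEffect, h1]
  have hvalk : applyInstr k .sleep c k = .sleeping := by
    simp [applyInstr_apply, siteEffect, hc, SiteState.trySleep]
  have hik : ∀ i, (applyInstr k .sleep c i).IsActive → i ≠ k := by
    rintro i hi rfl
    rw [hvalk] at hi
    exact hi
  refine ⟨?_, ?_, ?_, ?_⟩
  · rw [hval 0 hk0.symm, h.origin]
  · intro e he i j hi hij hact hsl
    have h1 := hik i hact
    rw [hval i h1] at hact
    by_cases hjk : j = k
    · subst hjk
      have := hmin i hact
      rcases he with rfl | rfl
      · rw [abs_of_pos (by omega), abs_of_pos (by omega)] at this; omega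
      · rw [abs_of_neg (by omega), abs_of_neg (by omega)] at this; omega
    · rw [hval j hjk] at hsl
      exact h.sorted e he i j hi hij hact hsl
  · intro i hi
    rw [Multiset.filter_add, Multiset.card_add, hcard i hi, filter_eq_self_of_block hMk, hM]
    by_cases hik : i = k
    · subst hik
      rw [hvalk, hc]
      simp [SiteState.total]
    · rw [hval i hik]
      simp [hik]
  · intro i hi hact
    have h1 := hik i hact
    rw [hval i h1] at hact
    exact (hcopy i hi hact fun h => absurd h h1).trans (Multiset.le_add_right _ _)

/-- The copies in the other blocks remain when particles of one block are removed. -/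
theorem Compatible.sub (hn : 1 ≤ n) {M : Multiset ℤ} {k : ℤ} (h : Compatible η L c U)
    (hM : M.card = (copyAt η 0).card) (hMk : ∀ x ∈ M, blockIndex n x = k) (hMU : M ≤ U)
    (hcopy : |k| ≤ (L : ℤ) → 2 ≤ (c k).total → copyAt η k + M ≤ U) :
    (∀ i, |i| ≤ (L : ℤ) → ((U - M).filter (blockIndex n · = i)).card =
      (copyAt η 0).card * if i = k then (c i).total - 1 else (c i).total) ∧
    (∀ i, |i| ≤ (L : ℤ) → (c i).IsActive → (i = k → 2 ≤ (c k).total) → copyAt η i ≤ U - M) := by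
  constructor
  · intro i hi
    have h1 := h.card i hi
    conv_lhs at h1 => rw [← tsub_add_cancel_of_le hMU]
    rw [Multiset.filter_add, Multiset.card_add, filter_eq_self_of_block hMk, hM] at h1
    split_ifs at h1 ⊢ with hik
    · rw [Nat.mul_sub, mul_one]
      omega
    · omega
  · intro i hi hact hik
    by_cases hk : i = k
    · subst hk
      exact le_tsub_of_add_le_right (hcopy hi (hik rfl))
    · rw [Multiset.le_iff_count]
      intro z
      rw [Multiset.count_sub]
      have h1 := Multiset.count_le_of_le z (h.copy i hi hact)
      by_cases hz : z ∈ copyAt η i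
      · have : z ∉ M := fun hzM => hk ((blockIndex_of_mem_copyAt hn hz).symm.trans (hMk z hzM))
        rw [Multiset.count_eq_zero.2 this]
        omega
      · rw [Multiset.count_eq_zero.2 hz]
        exact Nat.zero_le _

theorem sleepers_jump {d k : ℤ} (hd : d = 1 ∨ d = -1) (hc : (c k).IsActive) :
    sleepers (applyInstr k (.jump (k - d)) c) = sleepers c \ {k - d} := by
  have hne : k - d ≠ k := by rcases hd with rfl | rfl <;> omega
  ext i
  simp only [sleepers, Set.mem_ofPred_eq, Set.mem_sdiff, Set.mem_singleton_iff, applyInstr_apply,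
    siteEffect]
  by_cases hi : i = k - d
  · rw [if_pos hi]
    have := SiteState.arrive_isActive (if i = k then (c i).leave else c i)
    constructor
    · intro h; rw [h] at this; exact this.elim
    · intro h; exact absurd hi h.2
  · by_cases hik : i = k
    · subst hik
      rcases h : c i with a | _
      · simp [SiteState.leave, hi]
      · rw [h] at hc; exact hc.elim
    · simp [hi, hik]

theorem sleepers_sleep {k : ℤ} (hc : c k = .active 1) :
    sleepers (applyInstr k .sleep c) = insert k (sleepers c) := by
  ext i
  simp only [sleepers, Set.mem_ofPred_eq, Set.mem_insert_iff, applyInstr_apply, siteEffect]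
  by_cases hik : i = k
  · subst hik; simp [hc, SiteState.trySleep]
  · simp [hik]

end

/-! ### Comparison in finite volume -/

section

variable {lam lam' : ℝ≥0} {P D : ℤ → PMF ℤ} {n L : ℕ}

/-- The comparison between the two models in finite volume. -/
theorem avoidProb_coarse_le (hPt : IsTranslationInvariant P) (hPn : IsNearestNeighbour P)
    (hn : 1 ≤ n) {η : box n → ℕ} (hDn : IsNearestNeighbour D) (hDo : IsDirectedToOrigin D)
    (hlam' : sleepWeight lam' = probNoExit lam P n η) (m : ℕ) {c : Config} {U : Multiset ℤ}
    (h : Compatible η L c U) (hm : potential L c < m) :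
    avoidProb lam' D {k | |k| ≤ (L : ℤ)} {0} c ≤
      avoidProb lam P (window n L) (block n 0) (blockState n (sleepers c) U) := by
  classical
  induction m generalizing c U with
  | zero => simp at hm
  | succ m ih =>
    set F := avoidProb lam P (window n L) (block n 0) with hF
    set F' := avoidProb lam' D {k | |k| ≤ (L : ℤ)} {0} with hF'
    by_cases hex : ∃ k, |k| ≤ (L : ℤ) ∧ (c k).IsActive
    swap
    · push Not at hex
      have : F (blockState n (sleepers c) U) = 1 := by
        refine avoidProb_eq_one fun x hx => ?_
        by_cases hs : blockIndex n x ∈ sleepers c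
        · rw [blockState_of_mem hs]
          split_ifs <;> simp [SiteState.IsActive]
        · rw [blockState_of_notMem hs]
          have h1 := SiteState.eq_empty_of_not_isActive (hex _ hx) hs
          have h2 := h.card _ hx
          rw [h1, SiteState.total, mul_zero, Multiset.card_eq_zero, Multiset.filter_eq_nil] at h2
          have : U.count x = 0 := Multiset.count_eq_zero.2 fun hxU => h2 x hxU rfl
          simp [this, SiteState.IsActive]
      rw [this]
      exact avoidProb_le_one _
    -- The active site nearest to the origin is toppled, which keeps sleepers from lying beyond
    -- active sites.
    · obtain ⟨k, ⟨hkL, hc⟩, hmin'⟩ := (measure Int.natAbs).wf.has_min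
        {k : ℤ | |k| ≤ (L : ℤ) ∧ (c k).IsActive} hex
      have hmin : ∀ i, (c i).IsActive → |k| ≤ |i| := by
        intro i hi
        by_contra hlt
        refine hmin' i ⟨by omega, hi⟩ ?_
        change i.natAbs < k.natAbs
        rw [Int.abs_eq_natAbs, Int.abs_eq_natAbs] at hlt
        omega
      have hk0 : k ≠ 0 := by
        rintro rfl
        rw [h.origin] at hc
        simp [SiteState.IsActive] at hc
      obtain ⟨d, hd, hdk⟩ : ∃ d : ℤ, (d = 1 ∨ d = -1) ∧ 1 ≤ d * k := by
        rcases lt_or_gt_of_ne hk0 with h | h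
        · exact ⟨-1, by simp, by omega⟩
        · exact ⟨1, by simp, by omega⟩
      have hdd : d * d = 1 := by rcases hd with rfl | rfl <;> rfl
      set Z' := sleepers c \ {k - d} with hZ'
      have hZ'beyond : ∀ j, d * (k - d) ≤ d * j → j ∉ Z' := by
        rintro j hj ⟨hj1, hj2⟩
        rw [mul_sub, hdd] at hj
        have hjd : j ≠ k - d := hj2
        by_cases hjk : j = k
        · subst hjk
          change c j = _ at hj1
          rw [hj1] at hc
          exact hc
        · refine h.sorted d hd k j hdk ?_ hc hj1
          rcases hd with rfl | rfl <;> omega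
      have hjump := avoidProb_directed (lam := lam') (S := {0}) hDn hDo hd hdk
        (show k ∈ {k : ℤ | |k| ≤ (L : ℤ)} from hkL) hc
      rw [← hF'] at hjump
      set cm := applyInstr k (.jump (k - d)) c with hcm
      -- A coarse jump: the particles `M`, inside block `k` or one step out of it, are exchanged for
      -- a copy of `η` in block `k - d`, to which the induction hypothesis applies. If `k - d = 0`
      -- the coarse model hits the origin and the bound is trivial.
      have hmv : ∀ U₀ M : Multiset ℤ, M.card = (copyAt η 0).card →
          (∀ x ∈ M, ∃ y, blockIndex n y = k ∧ |x - y| ≤ 1) →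
          (∀ i, |i| ≤ (L : ℤ) → (U₀.filter (blockIndex n · = i)).card =
            (copyAt η 0).card * if i = k then (c i).total - 1 else (c i).total) →
          (∀ i, |i| ≤ (L : ℤ) → (c i).IsActive → (i = k → 2 ≤ (c k).total) → copyAt η i ≤ U₀) →
          F' cm ≤ F (blockState n Z' (U₀ + M)) := by
        intro U₀ M hM hMk hcard hcopy
        by_cases hj : k - d = 0
        · have : F' cm = 0 := by
            refine avoidProb_eq_zero (x := 0) (by simp) (Set.mem_singleton 0) ?_
            rw [hcm, hj]
            simp only [applyInstr, Function.update_self]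
            exact SiteState.arrive_isActive _
          rw [this]
          exact avoidProb_nonneg _
        · have h1 := ih (h.jump hn hd hdk hj hc hcard hcopy)
            (lt_of_lt_of_le (potential_jump_lt hd hdk hkL hc) (Nat.lt_succ_iff.1 hm))
          rw [sleepers_jump hd hc] at h1
          have hbi : ∀ y ∈ copyAt η (k - d), blockIndex n y = k - d :=
            fun y hy => blockIndex_of_mem_copyAt hn hy
          refine h1.trans (avoidProb_move_multiset hPt hPn hn hd ?_ ?_ ?_ ?_)
          · rw [hM, card_copyAt_eq η (k - d)]
          · intro x hx y hy
            obtain ⟨x', hx', hxx⟩ := hMk x hx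
            have : d * y < d * x' := by
              by_contra hle
              have := mul_blockIndex_mono hn hd (not_lt.1 hle)
              rw [hx', hbi y hy, mul_sub, hdd] at this
              omega
            rw [abs_le] at hxx
            rcases hd with rfl | rfl <;> omega
          · intro y hy
            rw [hbi y hy]
            rcases hd with rfl | rfl <;> omega
          · intro y hy j hj
            rw [hbi y hy] at hj
            exact hZ'beyond j hj
      have hcopyk := h.copy k hkL hc
      have hcopyW : copyAt η k ≤ U.filter (blockIndex n · = k) :=
        Multiset.le_filter.2 ⟨hcopyk, fun x hx => blockIndex_of_mem_copyAt hn hx⟩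
      have hWcard := h.card k hkL
      -- With several coarse particles at `k`, the moved particles are taken outside the copy of
      -- `η`, which remains available. No toppling is needed in the block model.
      by_cases htwo : 2 ≤ (c k).total
      · obtain ⟨M, hMW, hM⟩ := exists_le_card_eq
          (U.filter (blockIndex n · = k) - copyAt η k) (m := (copyAt η 0).card) (by
            rw [Multiset.card_sub hcopyW, hWcard, card_copyAt_eq η k]
            have := Nat.mul_le_mul_left (copyAt η 0).card htwo
            omega)
        have hMW' : copyAt η k + M ≤ U.filter (blockIndex n · = k) := by
          rw [add_comm]
          exact (le_tsub_iff_right hcopyW).1 hMW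
        have hMk : ∀ x ∈ M, blockIndex n x = k := fun x hx =>
          (Multiset.mem_filter.1 (Multiset.mem_of_le ((Multiset.le_add_left _ _).trans hMW') hx)).2
        have hMU' : copyAt η k + M ≤ U := hMW'.trans (Multiset.filter_le _ _)
        have hMU : M ≤ U := (Multiset.le_add_left _ _).trans hMU'
        obtain ⟨h1, h2⟩ := h.sub hn hM hMk hMU fun _ _ => hMU'
        have h3 := hmv (U - M) M hM (fun x hx => ⟨x, hMk x hx, by simp⟩) h1 h2
        rw [tsub_add_cancel_of_le hMU] at h3
        have h4 : F (blockState n Z' U) ≤ F (blockState n (sleepers c) U) :=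
          avoidProb_anti fun x _ => blockState_mono (fun h => h.1) le_rfl
        have hcs : applyInstr k .sleep c = c := by
          funext i
          rw [applyInstr_apply, siteEffect]
          split_ifs with hi
          · subst hi
            rcases h' : c i with (_ | _ | a) | _ <;> rw [h'] at htwo <;>
              simp [SiteState.total, SiteState.trySleep] at htwo ⊢
          · rfl
        rw [hcs] at hjump
        have h5 := sleepWeight_lt_one (lam := lam')
        -- The sleep instruction does not change `c`, so its weight, which is less than 1, cancels.
        have h6 : F' c ≤ F' cm := by
          by_contra hlt
          have := mul_pos (sub_pos.2 h5) (sub_pos.2 (not_le.1 hlt))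
          linarith
        exact h6.trans (h3.trans h4)
      · have hone : c k = .active 1 := by
          rcases h' : c k with (_ | _ | a) | _ <;> rw [h'] at htwo hc <;>
            simp [SiteState.total, SiteState.IsActive] at htwo hc ⊢
        obtain ⟨h1, h2⟩ := h.sub hn (card_copyAt_eq η k)
          (fun x hx => blockIndex_of_mem_copyAt hn hx) hcopyk fun _ h => absurd h htwo
        have hnear : ∀ M : Multiset ℤ, (∀ x ∈ M, blockIndex n x = k) →
            ∀ x ∈ M, ∃ y, blockIndex n y = k ∧ |x - y| ≤ 1 :=
          fun M hMk x hx => ⟨x, hMk x hx, by simp⟩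
        have hkZ : k ∉ sleepers c := by simp [sleepers, hone]
        have hU0 : ∀ x ∈ U - copyAt η k, blockIndex n x ≠ k := by
          have := h1 k hkL
          rw [if_pos rfl, hone, SiteState.total, Nat.sub_self, mul_zero, Multiset.card_eq_zero,
            Multiset.filter_eq_nil] at this
          exact this
        have hmain := avoidProb_copyAt (lam := lam) (L := L) hPt hPn hn (Z := sleepers c)
          (Z' := Z') hU0 hk0 hkZ Set.sdiff_subset (fun j hj => hZ'beyond j (by
            rw [abs_le] at hj
            rw [mul_sub, hdd]
            rcases hd with rfl | rfl <;> omega))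
          -- The maximum supplies `B ≤ A` without comparing the two coarse outcomes; the block
          -- asleep at `k` satisfies both lower bounds.
          (A := max (F' (applyInstr k .sleep c)) (F' cm)) (B := F' cm) (le_max_right _ _)
          (by
            have h3 : F' (applyInstr k .sleep c) ≤ 1 := avoidProb_le_one _
            have h4 : 0 ≤ F' cm := avoidProb_nonneg _
            have h5 : F' cm ≤ 1 := avoidProb_le_one _
            have := max_le h3 h5
            linarith)
          (by
            intro M hM hMk
            rw [card_copyAt_eq] at hM
            refine max_le ?_ ?_
            · have := ih (h.sleep hk0 hone hmin hM hMk h1 h2)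
                (lt_of_lt_of_le (potential_sleep_lt hkL hone) (Nat.lt_succ_iff.1 hm))
              rwa [sleepers_sleep hone] at this
            · refine (hmv _ M hM (hnear M hMk) h1 h2).trans
                (avoidProb_anti fun x _ => blockState_mono (fun h => ?_) le_rfl)
              exact Set.mem_insert_of_mem _ h.1)
          (by
            intro M hM hMk
            rw [card_copyAt_eq] at hM
            exact hmv _ M hM hMk h1 h2)
        rw [tsub_add_cancel_of_le hcopyk] at hmain
        refine le_trans ?_ hmain
        have h3 := mul_le_mul_of_nonneg_left
          (le_max_left (F' (applyInstr k .sleep c)) (F' cm)) (sleepWeight_nonneg (lam := lam'))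
        rw [hlam'] at h3 hjump
        linarith

end

/-! ### Passage to infinite volume -/

section

variable {n : ℕ}

/-- The particles of `blockConfig η ξ` in the blocks `-L, …, L`. -/
noncomputable def blockParticles (η : box n → ℕ) (ξ : ℤ → ℕ) (L : ℕ) : Multiset ℤ :=
  ∑ k ∈ Finset.Icc (-(L : ℤ)) L, ξ k • copyAt η k

theorem compatible_allActive (hn : 1 ≤ n) (η : box n → ℕ) {ξ : ℤ → ℕ} (h0 : ξ 0 = 0) (L : ℕ) :
    Compatible η L (allActive ξ) (blockParticles η ξ L) := by
  refine ⟨by simp [allActive, h0], fun _ _ _ _ _ _ _ h => by simp [allActive] at h, ?_, ?_⟩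
  · intro k hk
    rw [← Multiset.countP_eq_card_filter, ← Multiset.coe_countPAddMonoidHom, blockParticles,
      map_sum, Finset.sum_eq_single k]
    · rw [map_nsmul, Multiset.coe_countPAddMonoidHom, Multiset.countP_eq_card_filter,
        filter_eq_self_of_block (fun x hx => blockIndex_of_mem_copyAt hn hx), if_pos rfl,
        card_copyAt_eq η k]
      simp [allActive, SiteState.total, mul_comm]
    · intro i _ hik
      rw [map_nsmul, Multiset.coe_countPAddMonoidHom, Multiset.countP_eq_card_filter,
        filter_eq_self_of_block (fun x hx => blockIndex_of_mem_copyAt hn hx), if_neg hik.symm,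
        smul_zero]
    · intro h
      exact absurd (mem_Icc_iff_abs_le.2 hk) h
  · intro k hk hact
    have h1 : 1 ≤ ξ k := hact
    calc copyAt η k = 1 • copyAt η k := (one_nsmul _).symm
      _ ≤ ξ k • copyAt η k := nsmul_le_nsmul_left (Multiset.zero_le _) h1
      _ ≤ blockParticles η ξ L :=
        Finset.single_le_sum (f := fun k => ξ k • copyAt η k) (fun _ _ => Multiset.zero_le _)
          (mem_Icc_iff_abs_le.2 hk)

theorem blockState_blockParticles (hn : 1 ≤ n) (η : box n → ℕ) (ξ : ℤ → ℕ) {L : ℕ} {x : ℤ}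
    (hx : x ∈ window n L) : blockState n (sleepers (allActive ξ)) (blockParticles η ξ L) x =
      allActive (blockConfig η ξ) x := by
  rw [blockState_of_notMem (by simp [sleepers, allActive]), allActive, blockParticles,
    Multiset.count_sum', Finset.sum_eq_single (blockIndex n x)]
  · rw [Multiset.count_nsmul, count_copyAt, blockConfig]
  · intro k _ hk
    rw [Multiset.count_nsmul, Multiset.count_eq_zero.2, mul_zero]
    exact fun h => hk (blockIndex_of_mem_copyAt hn h).symm
  · intro h
    exact absurd (mem_Icc_iff_abs_le.2 hx) h

theorem exists_subset_window (α : List ℤ) : ∃ L : ℕ, ∀ y ∈ α, y ∈ window n L := by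
  induction α with
  | nil => exact ⟨0, by simp⟩
  | cons x α ih =>
    obtain ⟨L, hL⟩ := ih
    refine ⟨max L (blockIndex n x).natAbs, fun y hy => ?_⟩
    rcases List.mem_cons.1 hy with rfl | hy
    · change |blockIndex n y| ≤ _
      rw [Int.abs_eq_natAbs]
      exact_mod_cast le_max_right _ _
    · have : |blockIndex n y| ≤ (L : ℤ) := hL y hy
      refine this.trans ?_
      exact_mod_cast le_max_left _ _

/-- A legal sequence is finite, hence contained in some window; continuity from above then applies.
-/
theorem tendsto_avoidProb_window (lam : ℝ≥0) (P : ℤ → PMF ℤ) (S : Set ℤ) (c : Config) :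
    Filter.Tendsto (fun L : ℕ => avoidProb lam P (window n L) S c) Filter.atTop
      (nhds (avoidProb lam P Set.univ S c)) := by
  have hanti : Antitone fun L : ℕ => {τ : InstrArray | ¬ CanHit (window n L) S τ (c, fun _ => 0)} := by
    rintro L L' hL τ h ⟨α, h1, h2, h3⟩
    refine h ⟨α, h1, fun y hy => ?_, h3⟩
    have : |blockIndex n y| ≤ (L : ℤ) := h2 y hy
    exact this.trans (by exact_mod_cast hL)
  have hinter : {τ : InstrArray | ¬ CanHit Set.univ S τ (c, fun _ => 0)} =
      ⋂ L : ℕ, {τ : InstrArray | ¬ CanHit (window n L) S τ (c, fun _ => 0)} := by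
    ext τ
    simp only [Set.mem_iInter, Set.mem_ofPred_eq]
    constructor
    · rintro h L ⟨α, h1, -, h3⟩
      exact h ⟨α, h1, fun _ _ => Set.mem_univ _, h3⟩
    · rintro h ⟨α, h1, -, h3⟩
      obtain ⟨L, hL⟩ := exists_subset_window (n := n) α
      exact h L ⟨α, h1, hL, h3⟩
  unfold avoidProb Measure.real
  rw [hinter]
  refine (ENNReal.tendsto_toReal (measure_ne_top _ _)).comp
    (tendsto_measure_iInter_atTop (fun L => ?_) hanti ⟨0, measure_ne_top _ _⟩)
  exact (measurableSet_canHit _ _ _).compl.nullMeasurableSet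

/-- The reason for the choice `λ' = p / (1 - p)`. -/
theorem sleepWeight_div {p : ℝ≥0} (hp : p < 1) : sleepWeight (p / (1 - p)) = p := by
  have h1 : (0 : ℝ) < 1 - p := sub_pos.2 (by exact_mod_cast hp)
  rw [sleepWeight, NNReal.coe_div, NNReal.coe_sub hp.le, NNReal.coe_one]
  field_simp
  ring

/-- The comparison between the two models for a fixed initial configuration. -/
theorem avoidProb_allActive_le {lam : ℝ≥0} {P D : ℤ → PMF ℤ} (hPt : IsTranslationInvariant P)
    (hPn : IsNearestNeighbour P) (hn : 1 ≤ n) {η : box n → ℕ} (hη : η ≠ 0)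
    (hDn : IsNearestNeighbour D) (hDo : IsDirectedToOrigin D) (ξ : ℤ → ℕ) :
    avoidProb (probNoExit lam P n η / (1 - probNoExit lam P n η)) D Set.univ {0} (allActive ξ) ≤
      avoidProb lam P Set.univ (block n 0) (allActive (blockConfig η ξ)) := by
  by_cases h0 : ξ 0 = 0
  · refine ge_of_tendsto' (tendsto_avoidProb_window (n := n) lam P _ _) fun L => ?_
    have h1 := avoidProb_coarse_le (lam := lam) hPt hPn hn hDn hDo
      (sleepWeight_div (probNoExit_lt_one hPt hPn hη)) _ (compatible_allActive hn η h0 L)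
      (Nat.lt_succ_self _)
    refine le_trans (measureReal_mono ?_) (h1.trans (avoidProb_anti fun z hz => ?_))
    · rintro τ h ⟨α, h1, -, h3⟩
      exact h ⟨α, h1, fun _ _ => Set.mem_univ _, h3⟩
    · rw [blockState_blockParticles hn η ξ hz]
  -- A particle starting at the origin makes the coarse avoidance probability zero.
  · rw [avoidProb_eq_zero (Set.mem_univ 0) (Set.mem_singleton 0)
      (by simpa [allActive, SiteState.IsActive, Nat.one_le_iff_ne_zero] using h0)]
    exact avoidProb_nonneg _

end

/-! ### Coupling and conclusion -/

theorem odometer_eq_zero_iff (τ : InstrArray) (c : Config) (x : ℤ) :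
    odometer τ c x = 0 ↔ ∀ α : List ℤ, IsLegal τ α (c, fun _ => 0) → x ∉ α := by
  rw [odometer]
  simp only [← bot_eq_zero, iSup_eq_bot]
  simp [List.count_eq_zero]

theorem forall_odometer_eq_zero_iff (τ : InstrArray) (c : Config) (S : Set ℤ) :
    (∀ x ∈ S, odometer τ c x = 0) ↔ ¬ CanHit Set.univ S τ (c, fun _ => 0) := by
  simp only [odometer_eq_zero_iff, CanHit]
  constructor
  · rintro h ⟨α, h1, -, x, h3, h4⟩
    exact h x h4 α h1 h3
  · intro h x hx α hα hxα
    exact h ⟨α, hα, fun _ _ => Set.mem_univ _, x, hxα, hx⟩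

theorem measurable_allActive_apply {Ω : Type*} [MeasurableSpace Ω] {ξ : Ω → ℤ → ℕ}
    (hξ : Measurable ξ) (z : ℤ) : Measurable fun ω => allActive (ξ ω) z :=
  (measurable_from_top (f := SiteState.active)).comp ((measurable_pi_apply z).comp hξ)

/-- Two events on two probability spaces can be coupled so that one is included in the other as soon
as their probabilities are ordered. -/
theorem exists_coupling {X Y : Type*} [MeasurableSpace X] [MeasurableSpace Y] (μ : Measure X)
    (ν : Measure Y) [IsProbabilityMeasure μ] [IsProbabilityMeasure ν] {A : Set X} {B : Set Y}
    (hA : MeasurableSet A) (hB : MeasurableSet B) (h : μ A ≤ ν B) :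
    ∃ π : Measure (X × Y), π.map Prod.fst = μ ∧ π.map Prod.snd = ν ∧ π (A ×ˢ Bᶜ) = 0 := by
  -- In these degenerate cases the independent coupling works; otherwise all normalizations below
  -- are by nonzero masses.
  by_cases hprod : μ A = 0 ∨ ν B = 1
  · refine ⟨μ.prod ν, by simp, by simp, ?_⟩
    rw [Measure.prod_prod]
    rcases hprod with h | h
    · rw [h, zero_mul]
    · rw [(prob_compl_eq_zero_iff hB).2 h, mul_zero]
  · push Not at hprod
    obtain ⟨ha, hb1⟩ := hprod
    have hb : ν B ≠ 0 := fun h0 => ha (le_antisymm (h0 ▸ h) bot_le)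
    have hbt : ν B ≠ ⊤ := measure_ne_top _ _
    have hat : μ A ≠ ⊤ := measure_ne_top _ _
    obtain ⟨t, ht⟩ : ∃ t, μ A / ν B + t = 1 :=
      exists_add_of_le (ENNReal.div_le_of_le_mul (by rwa [one_mul])) |>.imp fun _ h => h.symm
    -- `σ` is what remains of `ν` after using the fraction `μ A / ν B` of its part on `B`. The part
    -- of `μ` on `A` is paired with `B` only, its part on `Aᶜ` with `σ`.
    set σ : Measure Y := t • ν.restrict B + ν.restrict Bᶜ with hσ
    have hν : (μ A / ν B) • ν.restrict B + σ = ν := by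
      rw [hσ, ← add_assoc, ← add_smul, ht, one_smul, Measure.restrict_add_restrict_compl hB]
    have hσu : σ Set.univ = μ Aᶜ := by
      have h1 := congrArg (fun m : Measure Y => m Set.univ) hν
      simp only [Measure.add_apply, Measure.smul_apply, Measure.restrict_apply_univ, smul_eq_mul,
        measure_univ, ENNReal.div_mul_cancel hb hbt] at h1
      rw [← prob_add_prob_compl (μ := μ) hA] at h1
      exact (ENNReal.add_right_inj hat).1 h1
    have hs : μ Aᶜ ≠ 0 := by
      intro h0
      have h1 : μ A + μ Aᶜ = 1 := prob_add_prob_compl hA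
      rw [h0, add_zero] at h1
      exact hb1 (le_antisymm prob_le_one (h1 ▸ h))
    have hst : μ Aᶜ ≠ ⊤ := measure_ne_top _ _
    have : IsFiniteMeasure σ := ⟨by rw [hσu]; exact hst.lt_top⟩
    refine ⟨(ν B)⁻¹ • (μ.restrict A).prod (ν.restrict B) +
      (μ Aᶜ)⁻¹ • (μ.restrict Aᶜ).prod σ, ?_, ?_, ?_⟩
    · rw [Measure.map_add _ _ measurable_fst, Measure.map_smul, Measure.map_smul,
        Measure.map_fst_prod, Measure.map_fst_prod, hσu, Measure.restrict_apply_univ, smul_smul,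
        smul_smul, ENNReal.inv_mul_cancel hb hbt, ENNReal.inv_mul_cancel hs hst, one_smul,
        one_smul, Measure.restrict_add_restrict_compl hA]
    · rw [Measure.map_add _ _ measurable_snd, Measure.map_smul, Measure.map_smul,
        Measure.map_snd_prod, Measure.map_snd_prod, Measure.restrict_apply_univ,
        Measure.restrict_apply_univ, smul_smul, smul_smul, ENNReal.inv_mul_cancel hs hst, one_smul,
        mul_comm, ← div_eq_mul_inv, hν]
    · simp [Measure.prod_prod, Measure.restrict_apply hA, Measure.restrict_apply hB.compl]

end ARW

theorem mainTheorem5 (lam : ℝ≥0) (hlam : 0 < lam)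
    (P : ℤ → PMF ℤ) (hPt : ARW.IsTranslationInvariant P) (hPn : ARW.IsNearestNeighbour P)
    (n : ℕ) (hn : 1 ≤ n) (η : ARW.box n → ℕ) (hη : η ≠ 0)
    (D : ℤ → PMF ℤ) (hDn : ARW.IsNearestNeighbour D) (hDo : ARW.IsDirectedToOrigin D)
    (ν : Measure (ℤ → ℕ)) [IsProbabilityMeasure ν] (p : ℝ≥0)
    (hp : p = ARW.probNoExit lam P n η) :
    p < 1 ∧
    ∃ (Ω : Type) (_ : MeasurableSpace Ω) (μ : Measure Ω)
      (ξ : Ω → ℤ → ℕ) (τ : Ω → ARW.InstrArray) (ξ' : Ω → ℤ → ℕ) (τ' : Ω → ARW.InstrArray),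
      IsProbabilityMeasure μ ∧
      Measurable ξ ∧ Measurable τ ∧ Measurable ξ' ∧ Measurable τ' ∧
      μ.map (fun ω => (ξ ω, τ ω)) = ARW.blockModel lam P η ν ∧
      μ.map (fun ω => (ξ' ω, τ' ω)) = ARW.arwModel (p / (1 - p)) D ν ∧
      {ω | ARW.odometer (τ' ω) (ARW.allActive (ξ' ω)) 0 = 0} ⊆
        {ω | ∀ x ∈ ARW.block n 0, ARW.odometer (τ ω) (ARW.allActive (ξ ω)) x = 0} := by
  subst hp
  refine ⟨ARW.probNoExit_lt_one hPt hPn hη, ?_⟩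
  set lam' := ARW.probNoExit lam P n η / (1 - ARW.probNoExit lam P n η) with hlam'
  have hmap : IsProbabilityMeasure (ν.map (ARW.blockConfig η)) :=
    Measure.isProbabilityMeasure_map (ARW.measurable_blockConfig η).aemeasurable
  have hb : IsProbabilityMeasure (ARW.blockModel lam P η ν) := by
    unfold ARW.blockModel; infer_instance
  have ha : IsProbabilityMeasure (ARW.arwModel lam' D ν) := by
    unfold ARW.arwModel; infer_instance
  let avoid : Set ℤ → Set ((ℤ → ℕ) × ARW.InstrArray) := fun S =>
    {q | ¬ ARW.CanHit Set.univ S q.2 (ARW.allActive q.1, fun _ => 0)}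
  have hm : ∀ S, MeasurableSet (avoid S) := fun S =>
    (ARW.measurableSet_canHit_comp measurable_snd
      (ARW.measurable_allActive_apply measurable_fst) Set.univ S _).compl
  -- By Fubini both sides are averages over the same `ξ` of law `ν`, so the comparison for fixed `ξ`
  -- suffices.
  have hle : ARW.arwModel lam' D ν (avoid {0}) ≤ ARW.blockModel lam P η ν (avoid (ARW.block n 0)) := by
    rw [ARW.arwModel, ARW.blockModel, Measure.prod_apply (hm _), Measure.prod_apply (hm _),
      lintegral_map (measurable_measure_prodMk_left (hm _)) (ARW.measurable_blockConfig η)]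
    refine lintegral_mono fun ξ => ?_
    exact (ENNReal.toReal_le_toReal (measure_ne_top _ _) (measure_ne_top _ _)).1
      (ARW.avoidProb_allActive_le hPt hPn hn hη hDn hDo ξ)
  obtain ⟨π, h1, h2, h3⟩ := ARW.exists_coupling _ _ (hm _) (hm _) hle
  -- The coupling gives the inclusion up to a null set; taking the complement `T` of that set as
  -- probability space makes it hold everywhere.
  have hT : MeasurableSet (avoid {0} ×ˢ (avoid (ARW.block n 0))ᶜ)ᶜ :=
    ((hm _).prod (hm _).compl).compl
  set T := (avoid {0} ×ˢ (avoid (ARW.block n 0))ᶜ)ᶜ with hTdef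
  have hπ : (π.comap ((↑) : T → _)).map ((↑) : T → _) = π := by
    rw [map_comap_subtype_coe hT, Measure.restrict_eq_self_of_ae_mem]
    rw [ae_iff]
    convert h3 using 2
    ext q
    simp [hTdef]
  refine ⟨T, inferInstance, π.comap (↑), fun ω => ω.1.2.1, fun ω => ω.1.2.2, fun ω => ω.1.1.1,
    fun ω => ω.1.1.2, ?_, by fun_prop, by fun_prop, by fun_prop, by fun_prop, ?_, ?_, ?_⟩
  · have hπp : IsProbabilityMeasure π := by
      constructor
      rw [← measure_univ (μ := ARW.arwModel lam' D ν), ← h1,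
        Measure.map_apply measurable_fst .univ, Set.preimage_univ]
    constructor
    rw [← measure_univ (μ := π)]
    conv_rhs => rw [← hπ]
    rw [Measure.map_apply measurable_subtype_coe .univ, Set.preimage_univ]
  · rw [← h2, ← hπ, Measure.map_map measurable_snd measurable_subtype_coe, hπ]
    rfl
  · rw [← h1, ← hπ, Measure.map_map measurable_fst measurable_subtype_coe, hπ]
    rfl
  · rintro ⟨⟨q', q⟩, hq⟩ h0
    have h4 : q' ∈ avoid {0} := by
      refine (ARW.forall_odometer_eq_zero_iff _ _ _).1 ?_
      rintro x rfl
      exact h0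
    have h5 : q ∈ avoid (ARW.block n 0) := by
      by_contra h5
      exact hq ⟨h4, h5⟩
    exact (ARW.forall_odometer_eq_zero_iff _ _ _).2 h5
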